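/- Let $\mathbb A$ be a set of propositional atoms (in particular, any countable one), and let the formulae be built from $\top$, $\bot$ and the atoms (these are the \emph{atomic} formulae) by $\neg,\wedge,\Box,\mathsf K$; write $\Diamond=\neg\Box\neg$ and $\mathsf L=\neg\mathsf K\neg$. The system $\mathbf{MP}^*$ has as axioms all propositional tautologies, $(A\to\Box A)\wedge(\neg A\to\Box\neg A)$ for atomic $A$, the $\mathbf{S4}$ axioms for $\Box$, the $\mathbf{S5}$ axioms for $\mathsf K$ (in the form $\mathsf K(\phi\to\psi)\to(\mathsf K\phi\to\mathsf K\psi)$, $\mathsf K\phi\to\phi$, $\mathsf K\phi\to\mathsf K\mathsf K\phi$, $\phi\to\mathsf K\mathsf L\phi$), $\mathsf K\Box\phi\to\Box\mathsf K\phi$, $\Diamond\Box\phi\to\Box\Diamond\phi$ and $$\Diamond(\mathsf K\phi\wedge\psi)\wedge\mathsf L\Diamond(\mathsf K\phi\wedge\chi)\to\Diamond(\mathsf K\Diamond\phi\wedge\Diamond\psi\wedge\mathsf L\Diamond\chi),$$ and as rules modus ponens and necessitation for $\mathsf K$ and $\Box$. Write $\Gamma\vdash\phi$ if $\bigwedge\Gamma_0\to\phi$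 is a theorem for some finite $\Gamma_0\subseteq\Gamma$; $\Gamma$ is consistent if $\Gamma\nvdash\bot$. For a set $X$ and $\mathcal O\subseteq\mathcal P(X)$ put $X\dot\times\mathcal O=\{(x,U): x\in U\in\mathcal O\}$. The \emph{subset frame} of $(X,\mathcal O)$ is $\langle X\dot\times\mathcal O,R_1,R_2\rangle$ with $(x,U)R_1(y,V)$ iff $x=y$ and $V\subseteq U$, and $(x,U)R_2(y,V)$ iff $U=V$. It is a \emph{closed topological frame} if $\mathcal O$ is the family of closed sets of a topology on $X$, i.e. is closed under arbitrary intersections and finite unions (empty ones included). A model over it is given by a map $i$ from atoms to $\mathcal P(X)$, with $x,U\models a$ iff $x\in i(a)$; $x,U\models\top$ always and $x,U\models\bot$ never; the usual clauses for $\neg,\wedge$; $x,U\models\Box\phi$ iff $x,V\models\phi$ for all $V\in\mathcal O$ with $x\in V\subseteq U$; $x,U\models\mathsf K\phi$ iff $y,U\models\phi$ for all $y\in U$. The \emph{canonical frame} of $\mathbf{MP}^*$ is $\langle S,R_1,R_2\rangle$, where $S$ is the set of maximal consistent sets, $sR_1t$ iff $\{\phi:\Box\phi\in s\}\subseteq t$,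 and $sR_2t$ iff $\{\phi:\mathsf K\phi\in s\}\subseteq t$. The subframe generated by $t\in S$ consists of the worlds reachable from $t$ by finitely many $R_1$- and $R_2$-steps. In a frame $\langle S,R_1,R_2\rangle$, a world $s_0$ is an \emph{ending point} of $s$ if $sR_1s'$ implies $s'R_1s_0$ for all $s'$; $s\,RR'\,t$ means that $sRr$ and $rR't$ for some $r$. The \emph{frame conditions} are: \begin{enumerate} \item $R_1$ is reflexive and transitive. \item $R_2$ is an equivalence relation. \item $R_1R_2\subseteq R_2R_1$. \item Every world has an ending point. \item For all $s,s'$: if $s,s'$ have a common $R_1$-successor, every $t$ with $tR_2s$ has a common $R_1$-successor with some $t'$ with $t'R_2s'$, and every $t'$ with $t'R_2s'$ has a common $R_1$-successor with some $t$ with $tR_2s$, then $s=s'$. \item For all $s_1,s_2$: if some $s$ satisfies $s\,R_2R_1\,s_1$ and $s\,R_2R_1\,s_2$, then there is $s'$ with $s'\,R_2R_1\,s_1$ and $s'\,R_2R_1\,s_2$ such that every $t$ with $tR_2s'$ satisfies $t\,R_1R_2\,s_1$ or $t\,R_1R_2\,s_2$. \item For every family $(s_i)_{i\in I}$: if there is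 $s$ with $s_iR_1s$ for all $i$, then there is $s'$ such that for every family $(t_i)_{i\in I}$ with $t_iR_2s_i$ for all $i$ and with some $t_0$ such that $t_iR_1t_0$ for all $i$, we have $t_i\,R_1R_2\,s'$ for all $i$. \item (Strong generation) There is $s$ with $s\,R_2R_1\,s'$ for all $s'$. \end{enumerate} Then: \begin{enumerate} \item[(a)] $\mathbf{MP}^*$ is strongly characterized by closed topological frames: for every set $\Gamma$ of formulae and every formula $\phi$, $\Gamma\vdash\phi$ if and only if $\phi$ holds at every pair $(x,U)$ of every model over a closed topological frame at which all of $\Gamma$ holds; equivalently, $\Gamma$ is consistent if and only if it is simultaneously satisfied at some pair $(x,U)$ of some model over a closed topological frame. \item[(b)] The canonical frame satisfies conditions 1--8. \item[(c)] For every $t\in S$, the subframe of the canonical frame generated by $t$ satisfies conditions 1--8 and is isomorphic to a closed topological frame. \item[(d)] The canonical frame is isomorphic to a closed topological frame. More precisely, let $X_c$ be the set of ending points of worlds of the canonical frame, $U_s=\{e : e\text{ is an ending point of some } t \text{ with } tR_2s\}$ for $s\in S$, $\mathcal O_c=\{\emptyset\}\cup\{U_s: s\in S\}$ and $i_c(a)=\{e\in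 X_c: a\in e\}$. Then $\mathcal O_c$ is the family of closed sets of a topology on $X_c$, and there is an isomorphism from the canonical frame onto the subset frame of $(X_c,\mathcal O_c)$ which sends each $s$ to $(s_0,U_s)$ with $s_0$ an ending point of $s$, and for which $\phi\in s$ iff $s_0,U_s\models\phi$ in $\langle X_c,\mathcal O_c,i_c\rangle$, for every formula $\phi$. \end{enumerate} -/

import Mathlib

universe u v

namespace MPStar

/-! ### Language -/

/-- Formulas of the bimodal language over propositional atoms `Atom`. The atomic formulas are
`⊤`, `⊥` and the formulas `atom a`. -/
inductive Formula (Atom : Type) : Type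
  | top : Formula Atom
  | bot : Formula Atom
  | atom (a : Atom) : Formula Atom
  | neg (φ : Formula Atom) : Formula Atom
  | and (φ ψ : Formula Atom) : Formula Atom
  | box (φ : Formula Atom) : Formula Atom
  | know (φ : Formula Atom) : Formula Atom

namespace Formula

variable {Atom : Type}

/-- Material implication. -/
def imp (φ ψ : Formula Atom) : Formula Atom := neg (and φ (neg ψ))

/-- The dual of the effort modality. -/
def dia (φ : Formula Atom) : Formula Atom := neg (box (neg φ))

/-- The dual `L` of the knowledge modality `K`. -/
def poss (φ : Formula Atom) : Formula Atom := neg (know (neg φ))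

/-- The atomic formulas, including the two distinguished ones `⊤` and `⊥`. -/
inductive IsAtomic : Formula Atom → Prop
  | top : IsAtomic top
  | bot : IsAtomic bot
  | atom (a : Atom) : IsAtomic (atom a)

/-- A propositional tautology: true under every assignment of truth values to formulas that
respects `⊤`, `⊥`, negation and conjunction (formulas `atom a`, `box φ`, `know φ` get arbitrary
truth values). -/
def IsTautology (φ : Formula Atom) : Prop :=
  ∀ v : Formula Atom → Prop,
    v top → ¬ v bot → (∀ ψ, v (neg ψ) ↔ ¬ v ψ) → (∀ ψ χ, v (and ψ χ) ↔ (v ψ ∧ v χ)) → v φ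

/-- Conjunction of a finite list of formulas. -/
def conj (l : List (Formula Atom)) : Formula Atom := l.foldr and top

end Formula

/-! ### The system `MP*` -/

open Formula in
/-- Theorems of the system `MP*`. -/
inductive Provable {Atom : Type} : Formula Atom → Prop
  | taut {φ : Formula Atom} : IsTautology φ → Provable φ
  | atomic {φ : Formula Atom} : IsAtomic φ →
      Provable (and (imp φ (box φ)) (imp (neg φ) (box (neg φ))))
  | box_normal (φ ψ : Formula Atom) :
      Provable (imp (box (imp φ ψ)) (imp (box φ) (box ψ)))
  | box_refl (φ : Formula Atom) : Provable (imp (box φ) φ)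
  | box_trans (φ : Formula Atom) : Provable (imp (box φ) (box (box φ)))
  | know_normal (φ ψ : Formula Atom) :
      Provable (imp (know (imp φ ψ)) (imp (know φ) (know ψ)))
  | know_refl (φ : Formula Atom) : Provable (imp (know φ) φ)
  | know_trans (φ : Formula Atom) : Provable (imp (know φ) (know (know φ)))
  | know_symm (φ : Formula Atom) : Provable (imp φ (know (poss φ)))
  | know_box (φ : Formula Atom) : Provable (imp (know (box φ)) (box (know φ)))
  | directed (φ : Formula Atom) : Provable (imp (dia (box φ)) (box (dia φ)))
  | union (φ ψ χ : Formula Atom) :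
      Provable (imp
        (and (dia (and (know φ) ψ)) (poss (dia (and (know φ) χ))))
        (dia (and (and (know (dia φ)) (dia ψ)) (poss (dia χ)))))
  | mp {φ ψ : Formula Atom} : Provable (imp φ ψ) → Provable φ → Provable ψ
  | know_nec {φ : Formula Atom} : Provable φ → Provable (know φ)
  | box_nec {φ : Formula Atom} : Provable φ → Provable (box φ)

/-- `Γ ⊢ φ` in `MP*`: some finite conjunction of members of `Γ` provably implies `φ`. -/
def Derives {Atom : Type} (Γ : Set (Formula Atom)) (φ : Formula Atom) : Prop :=
  ∃ l : List (Formula Atom), (∀ ψ ∈ l, ψ ∈ Γ) ∧ Provable (Formula.imp (Formula.conj l) φ)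

/-- `MP*`-consistency of a set of formulas. -/
def Consistent {Atom : Type} (Γ : Set (Formula Atom)) : Prop := ¬ Derives Γ Formula.bot

/-- `MP*`-maximal consistent sets of formulas. -/
def MaxConsistent {Atom : Type} (Γ : Set (Formula Atom)) : Prop :=
  Consistent Γ ∧ ∀ Δ : Set (Formula Atom), Consistent Δ → Γ ⊆ Δ → Δ = Γ

/-! ### Subset models -/

/-- Satisfaction `x, U ⊨ φ` in the model given by a family `O` of subsets of `X` and an initial
interpretation `i` (extended by `i ⊤ = X` and `i ⊥ = ∅`). It is used only at pairs `(x, U)` with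
`x ∈ U ∈ O`. -/
def Sat {Atom : Type} {X : Type v} (O : Set (Set X)) (i : Atom → Set X) :
    X → Set X → Formula Atom → Prop
  | _, _, .top => True
  | _, _, .bot => False
  | x, _, .atom a => x ∈ i a
  | x, U, .neg φ => ¬ Sat O i x U φ
  | x, U, .and φ ψ => Sat O i x U φ ∧ Sat O i x U ψ
  | x, U, .box φ => ∀ V ∈ O, V ⊆ U → x ∈ V → Sat O i x V φ
  | _, U, .know φ => ∀ y ∈ U, Sat O i y U φ

/-- `O` is the family of closed sets of some topology on `X`; see `isClosedTopology_iff`. -/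
def IsClosedTopology {X : Type v} (O : Set (Set X)) : Prop :=
  ∃ T : TopologicalSpace X, O = {C | @IsClosed X T C}

/-- The families of closed sets of a topology are the families closed under arbitrary
intersections and finite unions (the empty ones included). -/
theorem isClosedTopology_iff {X : Type v} (O : Set (Set X)) :
    IsClosedTopology O ↔
      (∀ C ⊆ O, ⋂₀ C ∈ O) ∧ ∅ ∈ O ∧ ∀ U ∈ O, ∀ V ∈ O, U ∪ V ∈ O := by
  constructor
  · rintro ⟨T, rfl⟩
    exact ⟨fun C hC => isClosed_sInter hC, isClosed_empty, fun U hU V hV => IsClosed.union hU hV⟩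
  · rintro ⟨h1, h2, h3⟩
    let T : TopologicalSpace X :=
      TopologicalSpace.ofClosed O h2 (fun C hC => h1 C hC) (fun U hU V hV => h3 U hU V hV)
    refine ⟨T, Set.ext fun C => ?_⟩
    change C ∈ O ↔ IsClosed C
    rw [← isOpen_compl_iff]
    change C ∈ O ↔ Cᶜᶜ ∈ O
    rw [compl_compl]

/-- The set `Γ` of formulas is simultaneously satisfied at some point of some model over a closed
topological frame. -/
def ClosedTopSatisfiable {Atom : Type} (Γ : Set (Formula Atom)) : Prop :=
  ∃ (X : Type v) (O : Set (Set X)) (i : Atom → Set X),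
    IsClosedTopology O ∧ ∃ x : X, ∃ U ∈ O, x ∈ U ∧ ∀ γ ∈ Γ, Sat O i x U γ

/-- `φ` is a (local) consequence of `Γ` over all models over closed topological frames. -/
def ClosedTopConsequence {Atom : Type} (Γ : Set (Formula Atom)) (φ : Formula Atom) : Prop :=
  ∀ (X : Type v) (O : Set (Set X)) (i : Atom → Set X),
    IsClosedTopology O → ∀ x : X, ∀ U ∈ O, x ∈ U → (∀ γ ∈ Γ, Sat O i x U γ) → Sat O i x U φ

/-! ### Frames -/

/-- A frame with two accessibility relations on the set of worlds `S`. -/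
structure Frame (S : Type u) where
  /-- accessibility for the effort modality -/
  R₁ : S → S → Prop
  /-- accessibility for the knowledge modality -/
  R₂ : S → S → Prop

/-- Isomorphisms of frames. -/
structure FrameIso {S : Type u} {T : Type v} (F : Frame S) (G : Frame T) extends S ≃ T where
  map_R₁ : ∀ s t, G.R₁ (toFun s) (toFun t) ↔ F.R₁ s t
  map_R₂ : ∀ s t, G.R₂ (toFun s) (toFun t) ↔ F.R₂ s t

/-- The pairs `(x, U)` with `x ∈ U ∈ O`. -/
abbrev PointedProduct {X : Type v} (O : Set (Set X)) : Type v :=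
  {p : X × Set X // p.2 ∈ O ∧ p.1 ∈ p.2}

/-- The subset frame of a family `O` of subsets of `X`. -/
def subsetFrame {X : Type v} (O : Set (Set X)) : Frame (PointedProduct O) where
  R₁ p q := p.1.1 = q.1.1 ∧ q.1.2 ⊆ p.1.2
  R₂ p q := p.1.2 = q.1.2

/-- The frame is isomorphic to the subset frame of the closed sets of a topological space. -/
def IsoToClosedTopologicalFrame {S : Type u} (F : Frame S) : Prop :=
  ∃ (X : Type u) (O : Set (Set X)), IsClosedTopology O ∧ Nonempty (FrameIso F (subsetFrame O))

/-- `e` is an ending point of `s`. -/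
def Frame.IsEndingPoint {S : Type u} (F : Frame S) (s e : S) : Prop :=
  ∀ s', F.R₁ s s' → F.R₁ s' e

open Relation in
/-- The eight frame conditions. `Relation.Comp R R' s t` means `∃ r, R s r ∧ R' r t`. -/
structure Frame.Conditions {S : Type u} (F : Frame S) : Prop where
  refl₁ : ∀ s, F.R₁ s s
  trans₁ : ∀ s t r, F.R₁ s t → F.R₁ t r → F.R₁ s r
  equiv₂ : Equivalence F.R₂
  comm : ∀ s t, Comp F.R₁ F.R₂ s t → Comp F.R₂ F.R₁ s t
  ending : ∀ s, ∃ s₀, F.IsEndingPoint s s₀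
  extensionality : ∀ s s',
    (∃ s₀, F.R₁ s s₀ ∧ F.R₁ s' s₀) →
    (∀ t, F.R₂ t s → ∃ t' t₀, F.R₂ t' s' ∧ F.R₁ t t₀ ∧ F.R₁ t' t₀) →
    (∀ t', F.R₂ t' s' → ∃ t t₀, F.R₂ t s ∧ F.R₁ t' t₀ ∧ F.R₁ t t₀) →
    s = s'
  union : ∀ s₁ s₂,
    (∃ s, Comp F.R₂ F.R₁ s s₁ ∧ Comp F.R₂ F.R₁ s s₂) →
    ∃ s', (Comp F.R₂ F.R₁ s' s₁ ∧ Comp F.R₂ F.R₁ s' s₂) ∧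
      ∀ t, F.R₂ t s' → Comp F.R₁ F.R₂ t s₁ ∨ Comp F.R₁ F.R₂ t s₂
  inter : ∀ (I : Type u) (s : I → S),
    (∃ r, ∀ i, F.R₁ (s i) r) →
    ∃ s', ∀ t : I → S,
      (∀ i, F.R₂ (t i) (s i)) → (∃ t₀, ∀ i, F.R₁ (t i) t₀) → ∀ i, Comp F.R₁ F.R₂ (t i) s'
  strongly_generated : ∃ s, ∀ s', Comp F.R₂ F.R₁ s s'

/-- The worlds reachable from `t` by finitely many steps along the two relations. -/
abbrev Frame.GeneratedSet {S : Type u} (F : Frame S) (t : S) : Type u :=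
  {s : S // Relation.ReflTransGen (fun a b => F.R₁ a b ∨ F.R₂ a b) t s}

/-- The subframe generated by the world `t`. -/
def Frame.generated {S : Type u} (F : Frame S) (t : S) : Frame (F.GeneratedSet t) where
  R₁ a b := F.R₁ a.1 b.1
  R₂ a b := F.R₂ a.1 b.1

/-! ### The canonical frame and the canonical subset model -/

/-- The worlds of the canonical frame of `MP*`. -/
abbrev CanonicalWorld (Atom : Type) : Type := {s : Set (Formula Atom) // MaxConsistent s}

/-- The canonical frame of `MP*`. -/
def canonicalFrame (Atom : Type) : Frame (CanonicalWorld Atom) where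
  R₁ s t := {φ | Formula.box φ ∈ s.1} ⊆ t.1
  R₂ s t := {φ | Formula.know φ ∈ s.1} ⊆ t.1

/-- The points of the canonical subset model: ending points of worlds of the canonical frame. -/
abbrev CanonicalPoint (Atom : Type) : Type :=
  {e : CanonicalWorld Atom // ∃ s, (canonicalFrame Atom).IsEndingPoint s e}

/-- The view `U_s` of a canonical world `s`: the ending points of the worlds `t` with
`t R₂ s`. -/
def canonicalView {Atom : Type} (s : CanonicalWorld Atom) : Set (CanonicalPoint Atom) :=
  {e | ∃ t, (canonicalFrame Atom).R₂ t s ∧ (canonicalFrame Atom).IsEndingPoint t e.1}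

/-- The sets of the canonical subset model: the views of canonical worlds, together with the empty
set (which contributes nothing to the pointed product). -/
def canonicalSets (Atom : Type) : Set (Set (CanonicalPoint Atom)) :=
  {C | C = ∅ ∨ ∃ s, C = canonicalView s}

/-- The initial interpretation of the canonical subset model. -/
def canonicalInterp {Atom : Type} (a : Atom) : Set (CanonicalPoint Atom) :=
  {e | Formula.atom a ∈ e.1.1}

end MPStar

namespace MPStar

open Formula

variable {Atom : Type}

/-! ### Derivations and maximal consistent sets -/

/-! Call a formula stable if its truth is constant along the canonical effort relation. Such a
formula speaks about the point only, not about the view. If `ψ` is stable, so is `inner ψ` (that is,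
`◇Kψ`), which will define a basic closed set. A canonical world then splits into a point, namely the
stable formulas it contains, and a view, namely the points satisfying every stable formula it knows.
The closed sets are the intersections of sets defined by formulas `inner ψ` with `ψ` stable.

Two compactness arguments make this a model. By `exists_R₁_stableView_eq`, a closed set containing
the point of `s` can be cut out of the view of `s` exactly, by passing to an effort successor;
finite consistency there comes from iterating the union axiom (`exists_shrinking_list`). By
`exists_R₂_agree`, every point in the view of `s` is the point of an epistemic alternative of `s`.
These give the truth lemma `mem_iff_sat`, and with soundness the strong completeness.

The truth lemma also shows that a world is determined by its point and its view, and that both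
canonical relations are those of a subset frame. Soundness applied to the model itself yields a
world whose view is the whole space, so that every nonempty closed set is a view. Each class of
worlds with the same stable formulas contains exactly one ending point, so ending points can serve
as the points; this gives `canonicalIso`. The eight conditions are checked in subset frames of
closed sets and transported along isomorphisms. The subframe generated by a world corresponds to the
closed subspace given by its view. -/

theorem valuation_imp {v : Formula Atom → Prop} (hn : ∀ ψ, v (neg ψ) ↔ ¬ v ψ)
    (ha : ∀ ψ χ, v (and ψ χ) ↔ (v ψ ∧ v χ)) (φ ψ : Formula Atom) :
    v (imp φ ψ) ↔ (v φ → v ψ) := by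
  simp only [imp, hn, ha]; tauto

theorem valuation_conj {v : Formula Atom → Prop} (ht : v top)
    (ha : ∀ ψ χ, v (and ψ χ) ↔ (v ψ ∧ v χ)) (l : List (Formula Atom)) :
    v (conj l) ↔ ∀ φ ∈ l, v φ := by
  induction l with
  | nil => simpa [conj] using ht
  | cons a l ih =>
    have : conj (a :: l) = and a (conj l) := rfl
    simp [this, ha, ih]

theorem Provable.mp_taut {φ ψ : Formula Atom} (h : Provable φ)
    (ht : IsTautology (imp φ ψ)) : Provable ψ := .mp (.taut ht) h

theorem Provable.mp_taut₂ {φ ψ χ : Formula Atom} (h : Provable φ) (h' : Provable ψ)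
    (ht : IsTautology (imp φ (imp ψ χ))) : Provable χ := .mp (.mp (.taut ht) h) h'

theorem Derives.of_mem {Γ : Set (Formula Atom)} {φ : Formula Atom} (h : φ ∈ Γ) :
    Derives Γ φ := by
  refine ⟨[φ], by simpa using h, .taut ?_⟩
  intro v ht _ hn ha
  simp [valuation_imp hn ha, valuation_conj ht ha]

theorem Derives.of_provable {Γ : Set (Formula Atom)} {φ : Formula Atom} (h : Provable φ) :
    Derives Γ φ := by
  refine ⟨[], by simp, h.mp_taut ?_⟩
  intro v ht _ hn ha
  simp only [valuation_imp hn ha]; tauto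

theorem Derives.mp {Γ : Set (Formula Atom)} {φ ψ : Formula Atom} (h : Derives Γ (imp φ ψ))
    (h' : Derives Γ φ) : Derives Γ ψ := by
  obtain ⟨l, hl, p⟩ := h
  obtain ⟨l', hl', p'⟩ := h'
  refine ⟨l ++ l', ?_, p.mp_taut₂ p' ?_⟩
  · intro χ hχ
    rcases List.mem_append.1 hχ with h | h
    exacts [hl _ h, hl' _ h]
  · intro v ht _ hn ha
    simp only [valuation_imp hn ha, valuation_conj ht ha, List.mem_append]
    intro h1 h2 h3
    exact h1 (fun χ hχ => h3 χ (.inl hχ)) (h2 fun χ hχ => h3 χ (.inr hχ))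

theorem Derives.deduction {Γ : Set (Formula Atom)} {φ ψ : Formula Atom}
    (h : Derives (insert φ Γ) ψ) : Derives Γ (imp φ ψ) := by
  obtain ⟨l, hl, p⟩ := h
  induction l generalizing ψ with
  | nil =>
    refine ⟨[], by simp, p.mp_taut ?_⟩
    intro v ht _ hn ha
    simp only [valuation_imp hn ha]; tauto
  | cons a l ih =>
    have hc : conj (a :: l) = and a (conj l) := rfl
    -- The head of the list moves into the conclusion, which is why the induction generalizes `ψ`.
    have key : Derives Γ (imp φ (imp a ψ)) := by
      refine ih (fun χ hχ => hl χ (List.mem_cons_of_mem _ hχ)) (p.mp_taut ?_)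
      intro v ht _ hn ha
      simp only [valuation_imp hn ha, hc, ha]; tauto
    rcases hl a List.mem_cons_self with rfl | hmem
    · refine Derives.mp (.of_provable (.taut ?_)) key
      intro v ht _ hn ha
      simp only [valuation_imp hn ha]; tauto
    · refine Derives.mp (Derives.mp (.of_provable (.taut ?_)) key) (.of_mem hmem)
      intro v ht _ hn ha
      simp only [valuation_imp hn ha]; tauto

theorem Derives.cut {Γ : Set (Formula Atom)} {φ ψ : Formula Atom}
    (h : Derives (insert φ Γ) ψ) (h' : Derives Γ φ) : Derives Γ ψ :=
  h.deduction.mp h'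

theorem consistent_insert_neg {Γ : Set (Formula Atom)} {φ : Formula Atom}
    (h : ¬ Derives Γ φ) : Consistent (insert (neg φ) Γ) := by
  intro hd
  refine h (Derives.mp (.of_provable (.taut ?_)) hd.deduction)
  intro v ht hb hn ha
  simp only [valuation_imp hn ha, hn]; tauto

theorem exists_maxConsistent {Γ : Set (Formula Atom)} (h : Consistent Γ) :
    ∃ w : CanonicalWorld Atom, Γ ⊆ w.1 := by
  obtain ⟨w, hΓ, hw⟩ := zorn_subset_nonempty {Δ : Set (Formula Atom) | Consistent Δ} (by
    intro c hc hchain hne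
    refine ⟨⋃₀ c, ?_, fun s hs => Set.subset_sUnion_of_mem hs⟩
    rintro ⟨l, hl, p⟩
    have : ∃ s ∈ c, ∀ ψ ∈ l, ψ ∈ s := by
      clear p
      induction l with
      | nil => exact ⟨_, hne.some_mem, by simp⟩
      | cons a l ih =>
        obtain ⟨s, hs, hsl⟩ := ih fun ψ hψ => hl ψ (List.mem_cons_of_mem _ hψ)
        obtain ⟨t, ht, hat⟩ := hl a List.mem_cons_self
        rcases hchain.total hs ht with hst | hts
        · exact ⟨t, ht, by simpa [hat] using fun ψ hψ => hst (hsl ψ hψ)⟩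
        · exact ⟨s, hs, by simpa [hts hat] using hsl⟩
    obtain ⟨s, hs, hsl⟩ := this
    exact hc hs ⟨l, hsl, p⟩) Γ h
  exact ⟨⟨w, hw.prop, fun Δ hΔ hwΔ => (hw.le_of_ge hΔ hwΔ).antisymm hwΔ⟩, hΓ⟩

namespace CanonicalWorld

variable (w : CanonicalWorld Atom)

theorem mem_of_derives {φ : Formula Atom} (h : Derives w.1 φ) : φ ∈ w.1 := by
  have hc : Consistent (insert φ w.1) := fun hd => w.2.1 (hd.cut h)
  rw [← w.2.2 _ hc (Set.subset_insert _ _)]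
  exact Set.mem_insert _ _

theorem mem_of_provable {φ : Formula Atom} (h : Provable φ) : φ ∈ w.1 :=
  mem_of_derives w (.of_provable h)

theorem mem_mp {φ ψ : Formula Atom} (h : Provable (imp φ ψ)) (h' : φ ∈ w.1) : ψ ∈ w.1 :=
  mem_of_derives w (.mp (.of_provable h) (.of_mem h'))

theorem top_mem : top ∈ w.1 := mem_of_provable w (.taut fun _ ht _ _ _ => ht)

theorem bot_notMem : bot ∉ w.1 := fun h => w.2.1 (.of_mem h)

theorem neg_mem {φ : Formula Atom} : neg φ ∈ w.1 ↔ φ ∉ w.1 := by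
  constructor
  · intro hn hp
    refine w.2.1 (.mp (.mp (.of_provable (.taut ?_)) (.of_mem hn)) (.of_mem hp))
    intro v ht hb hn ha
    simp only [valuation_imp hn ha, hn]; tauto
  · intro h
    have hc := consistent_insert_neg fun hd => h (mem_of_derives w hd)
    rw [← w.2.2 _ hc (Set.subset_insert _ _)]
    exact Set.mem_insert _ _

theorem and_mem {φ ψ : Formula Atom} : and φ ψ ∈ w.1 ↔ φ ∈ w.1 ∧ ψ ∈ w.1 := by
  constructor
  · refine fun h => ⟨mem_mp w (.taut ?_) h, mem_mp w (.taut ?_) h⟩ <;>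
    · intro v ht hb hn ha
      simp only [valuation_imp hn ha, ha]; tauto
  · rintro ⟨h, h'⟩
    refine mem_of_derives w (.mp (.mp (.of_provable (.taut ?_)) (.of_mem h)) (.of_mem h'))
    intro v ht hb hn ha
    simp only [valuation_imp hn ha, ha]; tauto

theorem imp_mem {φ ψ : Formula Atom} : imp φ ψ ∈ w.1 ↔ (φ ∈ w.1 → ψ ∈ w.1) :=
  valuation_imp (v := (· ∈ w.1)) (fun _ => neg_mem w) (fun _ _ => and_mem w) φ ψ

theorem conj_mem {l : List (Formula Atom)} : conj l ∈ w.1 ↔ ∀ φ ∈ l, φ ∈ w.1 :=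
  valuation_conj (v := (· ∈ w.1)) (top_mem w) (fun _ _ => and_mem w) l

theorem ext_of_subset {w w' : CanonicalWorld Atom} (h : w.1 ⊆ w'.1) : w = w' :=
  Subtype.ext (w.2.2 _ w'.2.1 h).symm

end CanonicalWorld

open CanonicalWorld

theorem provable_iff {φ : Formula Atom} :
    Provable φ ↔ ∀ w : CanonicalWorld Atom, φ ∈ w.1 := by
  refine ⟨fun h w => mem_of_provable w h, fun h => ?_⟩
  by_contra hp
  have : ¬ Derives ∅ φ := by
    rintro ⟨l, hl, p⟩
    have hl : l = [] := List.eq_nil_iff_forall_not_mem.2 fun ψ hψ => hl ψ hψ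
    subst hl
    refine hp (p.mp_taut ?_)
    intro v ht hb hn ha
    have : v (conj []) := ht
    simp only [valuation_imp hn ha]; tauto
  obtain ⟨w, hw⟩ := exists_maxConsistent (consistent_insert_neg this)
  exact (neg_mem w).1 (hw (Set.mem_insert _ _)) (h w)

/-- A downward directed set of formulas, each of which lies in some world, lies in a world. -/
theorem exists_world_of_directed {Δ : Set (Formula Atom)} (hne : Δ.Nonempty)
    (hdir : ∀ a ∈ Δ, ∀ b ∈ Δ, ∃ c ∈ Δ, ∀ w : CanonicalWorld Atom, c ∈ w.1 → a ∈ w.1 ∧ b ∈ w.1)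
    (hcons : ∀ a ∈ Δ, ∃ w : CanonicalWorld Atom, a ∈ w.1) :
    ∃ w : CanonicalWorld Atom, Δ ⊆ w.1 := by
  refine exists_maxConsistent ?_
  rintro ⟨l, hl, p⟩
  have : ∃ c ∈ Δ, ∀ w : CanonicalWorld Atom, c ∈ w.1 → ∀ a ∈ l, a ∈ w.1 := by
    clear p
    induction l with
    | nil => exact ⟨_, hne.some_mem, by simp⟩
    | cons a l ih =>
      obtain ⟨b, hb, hbl⟩ := ih fun ψ hψ => hl ψ (List.mem_cons_of_mem _ hψ)
      obtain ⟨c, hc, hcw⟩ := hdir a (hl a List.mem_cons_self) b hb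
      refine ⟨c, hc, fun w hw => ?_⟩
      simpa [(hcw w hw).1] using hbl w (hcw w hw).2
  obtain ⟨c, hc, hcl⟩ := this
  obtain ⟨w, hw⟩ := hcons c hc
  exact bot_notMem w (mem_mp w p ((conj_mem w).2 (hcl w hw)))

/-- The existence lemma for a normal modality. -/
theorem exists_world_of_notMem {m : Formula Atom → Formula Atom}
    (hnec : ∀ φ, Provable φ → Provable (m φ))
    (hnorm : ∀ φ ψ, Provable (imp (m (imp φ ψ)) (imp (m φ) (m ψ))))
    {s : CanonicalWorld Atom} {φ : Formula Atom} (h : m φ ∉ s.1) :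
    ∃ t : CanonicalWorld Atom, {χ | m χ ∈ s.1} ⊆ t.1 ∧ φ ∉ t.1 := by
  have mono : ∀ {α β : Formula Atom}, (∀ w : CanonicalWorld Atom, α ∈ w.1 → β ∈ w.1) →
      m α ∈ s.1 → m β ∈ s.1 := fun {α β} hab =>
    (imp_mem s).1 (mem_mp s (hnorm α β) (mem_of_provable s (hnec _
      (provable_iff.2 fun w => (imp_mem w).2 (hab w)))))
  have hand : ∀ {α β : Formula Atom}, m α ∈ s.1 → m β ∈ s.1 → m (and α β) ∈ s.1 := by
    intro α β ha
    refine (imp_mem s).1 (mem_mp s (hnorm _ _) (mono (fun w hα => ?_) ha))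
    exact (imp_mem w).2 fun hβ => (and_mem w).2 ⟨hα, hβ⟩
  have htop : m top ∈ s.1 := mem_of_provable s (hnec _ (.taut fun _ ht _ _ _ => ht))
  obtain ⟨t, ht⟩ := exists_world_of_directed (Δ := {α | ∃ χ, m χ ∈ s.1 ∧ α = and χ (neg φ)})
    ⟨_, top, htop, rfl⟩ (by
      rintro _ ⟨χ, hχ, rfl⟩ _ ⟨χ', hχ', rfl⟩
      refine ⟨_, ⟨_, hand hχ hχ', rfl⟩, fun w => ?_⟩
      simp only [and_mem]; tauto) (by
      rintro _ ⟨χ, hχ, rfl⟩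
      by_contra! hno
      refine h (mono (fun w hw => ?_) hχ)
      have := hno w
      simp only [and_mem, neg_mem] at this; tauto)
  refine ⟨t, fun χ hχ => ((and_mem t).1 (ht ⟨χ, hχ, rfl⟩)).1, ?_⟩
  exact (neg_mem t).1 ((and_mem t).1 (ht ⟨top, htop, rfl⟩)).2

/-! ### The relations of the canonical frame -/

theorem box_mem {s : CanonicalWorld Atom} {φ : Formula Atom} :
    box φ ∈ s.1 ↔ ∀ t, (canonicalFrame Atom).R₁ s t → φ ∈ t.1 := by
  refine ⟨fun h t ht => ht h, fun h => ?_⟩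
  by_contra hn
  obtain ⟨t, ht, hφ⟩ := exists_world_of_notMem (fun _ => .box_nec) .box_normal hn
  exact hφ (h t ht)

theorem know_mem {s : CanonicalWorld Atom} {φ : Formula Atom} :
    know φ ∈ s.1 ↔ ∀ t, (canonicalFrame Atom).R₂ s t → φ ∈ t.1 := by
  refine ⟨fun h t ht => ht h, fun h => ?_⟩
  by_contra hn
  obtain ⟨t, ht, hφ⟩ := exists_world_of_notMem (fun _ => .know_nec) .know_normal hn
  exact hφ (h t ht)

theorem dia_mem {s : CanonicalWorld Atom} {φ : Formula Atom} :
    dia φ ∈ s.1 ↔ ∃ t, (canonicalFrame Atom).R₁ s t ∧ φ ∈ t.1 := by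
  simp [dia, neg_mem, box_mem]

theorem poss_mem {s : CanonicalWorld Atom} {φ : Formula Atom} :
    poss φ ∈ s.1 ↔ ∃ t, (canonicalFrame Atom).R₂ s t ∧ φ ∈ t.1 := by
  simp [poss, neg_mem, know_mem]

theorem canonical_refl₁ (s : CanonicalWorld Atom) : (canonicalFrame Atom).R₁ s s :=
  fun φ h => mem_mp s (.box_refl φ) h

theorem canonical_trans₁ {s t r : CanonicalWorld Atom} (h : (canonicalFrame Atom).R₁ s t)
    (h' : (canonicalFrame Atom).R₁ t r) : (canonicalFrame Atom).R₁ s r :=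
  fun φ hφ => h' (h (mem_mp s (.box_trans φ) hφ))

theorem canonical_refl₂ (s : CanonicalWorld Atom) : (canonicalFrame Atom).R₂ s s :=
  fun φ h => mem_mp s (.know_refl φ) h

theorem canonical_trans₂ {s t r : CanonicalWorld Atom} (h : (canonicalFrame Atom).R₂ s t)
    (h' : (canonicalFrame Atom).R₂ t r) : (canonicalFrame Atom).R₂ s r :=
  fun φ hφ => h' (h (mem_mp s (.know_trans φ) hφ))

theorem canonical_symm₂ {s t : CanonicalWorld Atom} (h : (canonicalFrame Atom).R₂ s t) :
    (canonicalFrame Atom).R₂ t s := by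
  intro φ hφ
  by_contra hn
  have : know (poss (neg φ)) ∈ s.1 := mem_mp s (.know_symm _) ((neg_mem s).2 hn)
  obtain ⟨r, hr, hφr⟩ := poss_mem.1 (h this)
  exact (neg_mem r).1 hφr (hr hφ)

/-- This is the canonicity of `K□φ → □Kφ`. The world `r'` must contain what `s` knows and `◇ψ` for
each `ψ ∈ t`. If some `φ ∧ ◇ψ` of this kind lay in no world, `s` would contain `K□¬ψ`, hence `□K¬ψ`,
forcing `¬ψ` into `t`. -/
theorem canonical_comm {s r t : CanonicalWorld Atom} (h : (canonicalFrame Atom).R₁ s r)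
    (h' : (canonicalFrame Atom).R₂ r t) :
    ∃ r', (canonicalFrame Atom).R₂ s r' ∧ (canonicalFrame Atom).R₁ r' t := by
  obtain ⟨r', hr'⟩ := exists_world_of_directed
    (Δ := {α | ∃ φ ψ, know φ ∈ s.1 ∧ ψ ∈ t.1 ∧ α = and φ (dia ψ)})
    ⟨_, top, top, know_mem.2 fun w _ => top_mem w, top_mem t, rfl⟩ (by
      rintro _ ⟨φ, ψ, hφ, hψ, rfl⟩ _ ⟨φ', ψ', hφ', hψ', rfl⟩
      refine ⟨_, ⟨and φ φ', and ψ ψ', know_mem.2 fun w hw => (and_mem w).2 ⟨hw hφ, hw hφ'⟩,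
        (and_mem t).2 ⟨hψ, hψ'⟩, rfl⟩, fun w => ?_⟩
      simp only [and_mem, dia_mem]
      rintro ⟨⟨h1, h2⟩, x, hx, h3, h4⟩
      exact ⟨⟨h1, x, hx, h3⟩, h2, x, hx, h4⟩) (by
      rintro _ ⟨φ, ψ, hφ, hψ, rfl⟩
      by_contra! hno
      have : know (box (neg ψ)) ∈ s.1 := know_mem.2 fun w hw => by
        by_contra hb
        refine hno w ((and_mem w).2 ⟨hw hφ, ?_⟩)
        simpa [dia, neg_mem] using hb
      exact (neg_mem t).1 (h' (h (mem_mp s (.know_box _) this))) hψ)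
  refine ⟨r', fun φ hφ => ((and_mem r').1 (hr' ⟨φ, top, hφ, top_mem t, rfl⟩)).1, fun φ hφ => ?_⟩
  by_contra hn
  have := ((and_mem r').1 (hr' ⟨top, neg φ, know_mem.2 fun w _ => top_mem w,
    (neg_mem t).2 hn, rfl⟩)).2
  obtain ⟨x, hx, hnx⟩ := dia_mem.1 this
  exact (neg_mem x).1 hnx (hx hφ)

/-! ### Formulas whose truth is independent of the view -/

/-- A formula is stable if its truth is constant along the effort relation. -/
def Stable (φ : Formula Atom) : Prop :=
  ∀ s t, (canonicalFrame Atom).R₁ s t → (φ ∈ s.1 ↔ φ ∈ t.1)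

theorem Stable.atom (a : Atom) : Stable (.atom a : Formula Atom) := by
  intro s t h
  have := (and_mem s).1 (mem_of_provable s (.atomic (.atom a)))
  simp only [imp_mem, neg_mem] at this
  by_cases ha : Formula.atom a ∈ s.1
  · exact iff_of_true ha (h (this.1 ha))
  · exact iff_of_false ha ((neg_mem t).1 (h (this.2 ha)))

theorem Stable.top : Stable (.top : Formula Atom) :=
  fun s t _ => iff_of_true (top_mem s) (top_mem t)

theorem Stable.bot : Stable (.bot : Formula Atom) :=
  fun s t _ => iff_of_false (bot_notMem s) (bot_notMem t)

theorem Stable.neg {φ : Formula Atom} (h : Stable φ) : Stable (.neg φ) := by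
  intro s t hst
  simp only [neg_mem, h s t hst]

theorem Stable.and {φ ψ : Formula Atom} (h : Stable φ) (h' : Stable ψ) :
    Stable (.and φ ψ) := by
  intro s t hst
  simp only [and_mem, h s t hst, h' s t hst]

/-- By `canonical_comm`, every alternative of `t` is an effort successor of an alternative of `s`,
so stable knowledge persists when the view shrinks. -/
theorem Stable.know_mem_of_R₁ {φ : Formula Atom} (h : Stable φ) {s t : CanonicalWorld Atom}
    (hst : (canonicalFrame Atom).R₁ s t) (hs : know φ ∈ s.1) : know φ ∈ t.1 :=
  know_mem.2 fun _ hr =>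
    have ⟨_, hr', hr''⟩ := canonical_comm hst hr
    (h _ _ hr'').1 (hr' hs)

theorem Stable.poss_mem_of_R₁ {φ : Formula Atom} (h : Stable φ) {s t : CanonicalWorld Atom}
    (hst : (canonicalFrame Atom).R₁ s t) (ht : poss φ ∈ t.1) : poss φ ∈ s.1 := by
  obtain ⟨r, hr, hφ⟩ := poss_mem.1 ht
  obtain ⟨r', hr', hr''⟩ := canonical_comm hst hr
  exact poss_mem.2 ⟨r', hr', (h _ _ hr'').2 hφ⟩

/-- The interior of a stable formula: it holds at all points of some smaller view. -/
def inner (φ : Formula Atom) : Formula Atom := dia (know φ)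

theorem inner_mem {s : CanonicalWorld Atom} {φ : Formula Atom} :
    inner φ ∈ s.1 ↔ ∃ t, (canonicalFrame Atom).R₁ s t ∧ know φ ∈ t.1 := dia_mem

/-- Going up, stable knowledge persists, so `◇Kφ` gives `◇□Kφ` and the directedness axiom gives
`□◇Kφ`. Going down is transitivity of effort. -/
theorem Stable.inner {φ : Formula Atom} (h : Stable φ) : Stable (inner φ) := by
  intro s t hst
  constructor
  · intro hs
    obtain ⟨r, hr, hφ⟩ := inner_mem.1 hs
    have hd : dia (box (know φ)) ∈ s.1 :=
      dia_mem.2 ⟨r, hr, box_mem.2 fun r' hr' => h.know_mem_of_R₁ hr' hφ⟩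
    exact box_mem.1 (mem_mp s (.directed _) hd) t hst
  · intro ht
    obtain ⟨r, hr, hφ⟩ := inner_mem.1 ht
    exact inner_mem.2 ⟨r, canonical_trans₁ hst hr, hφ⟩

theorem Stable.mem_of_inner {φ : Formula Atom} (h : Stable φ) {s : CanonicalWorld Atom}
    (hs : MPStar.inner φ ∈ s.1) : φ ∈ s.1 := by
  obtain ⟨r, hr, hφ⟩ := inner_mem.1 hs
  exact (h s r hr).2 (know_mem.1 hφ r (canonical_refl₂ r))

theorem know_inner_mem {φ : Formula Atom} {s : CanonicalWorld Atom} (hs : know φ ∈ s.1) :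
    know (inner φ) ∈ s.1 :=
  know_mem.2 fun t ht =>
    inner_mem.2 ⟨t, canonical_refl₁ t, know_mem.2 fun _ hr => canonical_trans₂ ht hr hs⟩

theorem Stable.inner_inner_mem {φ : Formula Atom} (h : Stable φ) {s : CanonicalWorld Atom} :
    MPStar.inner (MPStar.inner φ) ∈ s.1 ↔ MPStar.inner φ ∈ s.1 := by
  refine ⟨h.inner.mem_of_inner, fun hs => ?_⟩
  obtain ⟨r, hr, hφ⟩ := inner_mem.1 hs
  exact inner_mem.2 ⟨r, hr, know_inner_mem hφ⟩

theorem know_and_mem {φ ψ : Formula Atom} {s : CanonicalWorld Atom} :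
    know (and φ ψ) ∈ s.1 ↔ know φ ∈ s.1 ∧ know ψ ∈ s.1 := by
  simp only [know_mem, and_mem, forall_and]

/-- For the converse, shrink twice: `inner ψ` survives the first shrinking because it is stable, and
`know φ` survives the second. -/
theorem Stable.inner_and_mem {φ ψ : Formula Atom} (h : Stable φ) (h' : Stable ψ)
    {s : CanonicalWorld Atom} :
    MPStar.inner (.and φ ψ) ∈ s.1 ↔ MPStar.inner φ ∈ s.1 ∧ MPStar.inner ψ ∈ s.1 := by
  constructor
  · intro hs
    obtain ⟨r, hr, hφ⟩ := inner_mem.1 hs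
    rw [know_and_mem] at hφ
    exact ⟨inner_mem.2 ⟨r, hr, hφ.1⟩, inner_mem.2 ⟨r, hr, hφ.2⟩⟩
  · rintro ⟨h1, h2⟩
    obtain ⟨r, hr, hφ⟩ := inner_mem.1 h1
    obtain ⟨r', hr', hψ⟩ := inner_mem.1 ((h'.inner s r hr).1 h2)
    exact inner_mem.2 ⟨r', canonical_trans₁ hr hr',
      know_and_mem.2 ⟨h.know_mem_of_R₁ hr' hφ, hψ⟩⟩

theorem inner_top_mem (s : CanonicalWorld Atom) : inner top ∈ s.1 :=
  inner_mem.2 ⟨s, canonical_refl₁ s, know_mem.2 fun t _ => top_mem t⟩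

/-- A view may be shrunk so that a stable formula becomes known while finitely many stable
formulas remain possible. -/
theorem exists_shrinking_list {s : CanonicalWorld Atom} {ψ : Formula Atom} (hψ : Stable ψ)
    (hs : inner ψ ∈ s.1) (l : List (Formula Atom))
    (hl : ∀ χ ∈ l, Stable χ ∧ poss (and χ (inner ψ)) ∈ s.1) :
    ∃ t, (canonicalFrame Atom).R₁ s t ∧ know ψ ∈ t.1 ∧ ∀ χ ∈ l, poss χ ∈ t.1 := by
  induction l with
  | nil => simpa using inner_mem.1 hs
  | cons χ l ih =>
    obtain ⟨t, hst, htψ, htl⟩ := ih fun χ' h => hl χ' (List.mem_cons_of_mem _ h)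
    obtain ⟨hχ, hp⟩ := hl χ List.mem_cons_self
    obtain ⟨y, hsy, hy⟩ := poss_mem.1 hp
    obtain ⟨hy1, hy2⟩ := (and_mem y).1 hy
    obtain ⟨z, hyz, hz⟩ := inner_mem.1 hy2
    -- The union axiom joins the view obtained for `l` with a view around `y` on which `ψ` is known.
    -- Stability then removes the diamonds from its conclusion.
    have h1 : dia (and (know ψ) (conj (l.map poss))) ∈ s.1 :=
      dia_mem.2 ⟨t, hst, (and_mem t).2 ⟨htψ, (conj_mem t).2 (by simpa using htl)⟩⟩
    have h2 : poss (dia (and (know ψ) χ)) ∈ s.1 :=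
      poss_mem.2 ⟨y, hsy, dia_mem.2 ⟨z, hyz, (and_mem z).2 ⟨hz, (hχ y z hyz).1 hy1⟩⟩⟩
    obtain ⟨t', hst', ht'⟩ := dia_mem.1 (mem_mp s (.union _ _ _) ((and_mem s).2 ⟨h1, h2⟩))
    simp only [and_mem] at ht'
    obtain ⟨⟨h3, h4⟩, h5⟩ := ht'
    refine ⟨t', hst', know_mem.2 fun r hr => ?_, ?_⟩
    · obtain ⟨r', hr', hψr'⟩ := dia_mem.1 (know_mem.1 h3 r hr)
      exact (hψ r r' hr').2 hψr'
    · intro χ' hχ'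
      rcases List.mem_cons.1 hχ' with rfl | hmem
      · obtain ⟨r, hr, hr2⟩ := poss_mem.1 h5
        obtain ⟨r', hr', hχr'⟩ := dia_mem.1 hr2
        exact poss_mem.2 ⟨r, hr, (hχ r r' hr').2 hχr'⟩
      · obtain ⟨r, hr, hr2⟩ := dia_mem.1 h4
        exact (hl χ' (List.mem_cons_of_mem _ hmem)).1.poss_mem_of_R₁ hr
          ((conj_mem r).1 hr2 _ (List.mem_map_of_mem hmem))

/-! ### Models on families of worlds -/

section Model

variable {X : Type v} (q : X → CanonicalWorld Atom)

/-- The view of a world `s`, in terms of stable formulas. -/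
def stableView (s : CanonicalWorld Atom) : Set X :=
  {x | ∀ φ, Stable φ → know φ ∈ s.1 → φ ∈ (q x).1}

/-- The points at which the interiors of the formulas in `κ` hold. -/
def innerSet (κ : Set (Formula Atom)) : Set X := {x | ∀ ψ ∈ κ, inner ψ ∈ (q x).1}

/-- The intersections of sets defined by interiors of stable formulas. -/
def stableSets : Set (Set X) :=
  {C | ∃ κ : Set (Formula Atom), (∀ ψ ∈ κ, Stable ψ) ∧ C = innerSet q κ}

/-- Two worlds agree if they contain the same stable formulas. -/
def Agree (s t : CanonicalWorld Atom) : Prop := ∀ φ, Stable φ → (φ ∈ s.1 ↔ φ ∈ t.1)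

theorem Agree.symm {s t : CanonicalWorld Atom} (h : Agree s t) : Agree t s :=
  fun φ hφ => (h φ hφ).symm

theorem Agree.trans {s t r : CanonicalWorld Atom} (h : Agree s t) (h' : Agree t r) : Agree s r :=
  fun φ hφ => (h φ hφ).trans (h' φ hφ)

theorem agree_of_R₁ {s t : CanonicalWorld Atom} (h : (canonicalFrame Atom).R₁ s t) :
    Agree s t := fun _ hφ => hφ s t h

theorem mem_stableView_of_agree {s : CanonicalWorld Atom} {x : X} (h : Agree (q x) s) :
    x ∈ stableView q s :=
  fun φ hφ hs => (h φ hφ).2 (know_mem.1 hs s (canonical_refl₂ s))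

theorem stableView_eq_of_R₂ {s t : CanonicalWorld Atom} (h : (canonicalFrame Atom).R₂ s t) :
    stableView q s = stableView q t := by
  ext x
  refine forall_congr' fun φ => forall_congr' fun _ => imp_congr_left ?_
  simp only [know_mem]
  exact ⟨fun h' r hr => h' r (canonical_trans₂ h hr),
    fun h' r hr => h' r (canonical_trans₂ (canonical_symm₂ h) hr)⟩

theorem stableView_subset_of_R₁ {s t : CanonicalWorld Atom}
    (h : (canonicalFrame Atom).R₁ s t) : stableView q t ⊆ stableView q s :=
  fun _ hx φ hφ hs => hx φ hφ (hφ.know_mem_of_R₁ h hs)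

theorem stableView_mem_stableSets (s : CanonicalWorld Atom) :
    stableView q s ∈ stableSets q := by
  refine ⟨{ψ | Stable ψ ∧ know ψ ∈ s.1}, fun ψ h => h.1, Set.ext fun x => ?_⟩
  exact ⟨fun h ψ hψ => h _ hψ.1.inner (know_inner_mem hψ.2),
    fun h ψ hψ hs => hψ.mem_of_inner (h ψ ⟨hψ, hs⟩)⟩

/-- Every set of the model containing the point of a world determines an effort successor. -/
theorem exists_R₁_stableView_eq {s : CanonicalWorld Atom} {κ : Set (Formula Atom)}
    (hκ : ∀ ψ ∈ κ, Stable ψ) (hs : ∀ ψ ∈ κ, inner ψ ∈ s.1) :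
    ∃ t, (canonicalFrame Atom).R₁ s t ∧ (∀ ψ ∈ κ, know ψ ∈ t.1) ∧
      stableView q t = stableView q s ∩ innerSet q κ := by
  -- The successor must satisfy the boxed formulas of `s`, know the stable formulas whose interiors
  -- hold in `s` and throughout the target set, and leave possible each stable formula true at some
  -- point of `stableView q s ∩ innerSet q κ`. Bounding `ψ` by its interior on `innerSet q κ`,
  -- rather than by membership in `κ`, makes the family closed under conjunction.
  obtain ⟨t, ht⟩ := exists_world_of_directed
    (Δ := {α | ∃ (φ ψ : Formula Atom) (l : List (Formula Atom)), box φ ∈ s.1 ∧ Stable ψ ∧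
      inner ψ ∈ s.1 ∧ (∀ x ∈ innerSet q κ, inner ψ ∈ (q x).1) ∧
      (∀ χ ∈ l, Stable χ ∧ ∃ x ∈ stableView q s ∩ innerSet q κ, χ ∈ (q x).1) ∧
      α = and φ (and (know ψ) (conj (l.map poss)))})
    ⟨_, top, top, [], box_mem.2 fun w _ => top_mem w, .top, inner_top_mem s,
      fun x _ => inner_top_mem _, by simp, rfl⟩ (by
      rintro _ ⟨φ, ψ, l, hφ, hψ, hψs, hψx, hl, rfl⟩ _ ⟨φ', ψ', l', hφ', hψ', hψs', hψx', hl', rfl⟩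
      refine ⟨_, ⟨and φ φ', and ψ ψ', l ++ l',
        box_mem.2 fun w hw => (and_mem w).2 ⟨hw hφ, hw hφ'⟩, hψ.and hψ',
        (hψ.inner_and_mem hψ').2 ⟨hψs, hψs'⟩,
        fun x hx => (hψ.inner_and_mem hψ').2 ⟨hψx x hx, hψx' x hx⟩, ?_, rfl⟩, fun w => ?_⟩
      · intro χ hχ
        rcases List.mem_append.1 hχ with h | h
        exacts [hl χ h, hl' χ h]
      · simp only [and_mem, know_and_mem, conj_mem, List.map_append, List.mem_append]
        rintro ⟨⟨h1, h2⟩, ⟨h3, h4⟩, h5⟩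
        exact ⟨⟨h1, h3, fun χ h => h5 χ (.inl h)⟩, h2, h4, fun χ h => h5 χ (.inr h)⟩) (by
      rintro _ ⟨φ, ψ, l, hφ, hψ, hψs, hψx, hl, rfl⟩
      obtain ⟨t, hst, ht, htl⟩ := exists_shrinking_list hψ hψs l (by
        intro χ hχ
        obtain ⟨hχs, x, hx, hχx⟩ := hl χ hχ
        refine ⟨hχs, ?_⟩
        -- Otherwise `s` knows the stable formula `¬(χ ∧ inner ψ)`, which fails at the point `x` of
        -- its view.
        by_contra hn
        rw [poss, neg_mem, not_not] at hn
        exact (neg_mem (q x)).1 (hx.1 _ (hχs.and hψ.inner).neg hn)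
          ((and_mem _).2 ⟨hχx, hψx x hx.2⟩))
      refine ⟨t, (and_mem t).2 ⟨hst hφ, (and_mem t).2 ⟨ht, (conj_mem t).2 ?_⟩⟩⟩
      simpa using htl)
  have hst : (canonicalFrame Atom).R₁ s t := fun φ hφ =>
    ((and_mem t).1 (ht ⟨φ, top, [], hφ, .top, inner_top_mem s,
      fun x _ => inner_top_mem _, by simp, rfl⟩)).1
  have hknow : ∀ ψ ∈ κ, know ψ ∈ t.1 := fun ψ hψ =>
    ((and_mem t).1 ((and_mem t).1 (ht ⟨top, ψ, [], box_mem.2 fun w _ => top_mem w, hκ ψ hψ,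
      hs ψ hψ, fun x hx => hx ψ hψ, by simp, rfl⟩)).2).1
  refine ⟨t, hst, hknow, Set.Subset.antisymm ?_ ?_⟩
  · exact fun x hx => ⟨stableView_subset_of_R₁ q hst hx,
      fun ψ hψ => hx _ (hκ ψ hψ).inner (know_inner_mem (hknow ψ hψ))⟩
  · intro x hx φ hφ hφt
    -- If `φ` failed at `x`, then `¬φ` would be among the formulas kept possible in `t`, although
    -- `t` knows `φ`.
    by_contra hn
    have : conj [poss (neg φ)] ∈ t.1 :=
      ((and_mem t).1 ((and_mem t).1 (ht ⟨top, top, [neg φ], box_mem.2 fun w _ => top_mem w, .top,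
        inner_top_mem s, fun x _ => inner_top_mem _,
        by simpa using ⟨hφ.neg, x, hx, (neg_mem _).2 hn⟩, rfl⟩)).2).2
    obtain ⟨r, hr, hφr⟩ := poss_mem.1 ((conj_mem t).1 this _ List.mem_cons_self)
    exact (neg_mem r).1 hφr (hr hφt)

/-- Every point of the view of a world carries an epistemic alternative of that world. -/
theorem exists_R₂_agree {s : CanonicalWorld Atom} {x : X} (hx : x ∈ stableView q s) :
    ∃ t, (canonicalFrame Atom).R₂ s t ∧ Agree (q x) t := by
  obtain ⟨t, ht⟩ := exists_world_of_directed
    (Δ := {α | ∃ φ ψ, know φ ∈ s.1 ∧ Stable ψ ∧ ψ ∈ (q x).1 ∧ α = and φ ψ})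
    ⟨_, top, top, know_mem.2 fun w _ => top_mem w, .top, top_mem _, rfl⟩ (by
      rintro _ ⟨φ, ψ, hφ, hψ, hψx, rfl⟩ _ ⟨φ', ψ', hφ', hψ', hψx', rfl⟩
      refine ⟨_, ⟨and φ φ', and ψ ψ', know_and_mem.2 ⟨hφ, hφ'⟩, hψ.and hψ',
        (and_mem _).2 ⟨hψx, hψx'⟩, rfl⟩, fun w => ?_⟩
      simp only [and_mem]; tauto) (by
      rintro _ ⟨φ, ψ, hφ, hψ, hψx, rfl⟩
      by_contra! hno
      -- If `φ ∧ ψ` lay in no world, `s` would know the stable formula `¬ψ`, which would then hold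
      -- at `x`.
      refine (neg_mem (q x)).1 (hx _ hψ.neg (know_mem.2 fun w hw => ?_)) hψx
      exact (neg_mem w).2 fun h => hno w ((and_mem w).2 ⟨hw hφ, h⟩))
  have h1 : ∀ φ, Stable φ → φ ∈ (q x).1 → φ ∈ t.1 := fun φ hφ h => ((and_mem t).1
    (ht ⟨top, φ, know_mem.2 fun w _ => top_mem w, hφ, h, rfl⟩)).2
  refine ⟨t, fun φ hφ => ((and_mem t).1 (ht ⟨φ, top, hφ, .top, top_mem _, rfl⟩)).1,
    fun φ hφ => ⟨h1 φ hφ, fun h => ?_⟩⟩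
  by_contra hn
  exact (neg_mem t).1 (h1 _ hφ.neg ((neg_mem _).2 hn)) h

/-- The valuation of the model. -/
def stableInterp (a : Atom) : Set X := {x | atom a ∈ (q x).1}

/-- The truth lemma. -/
theorem mem_iff_sat (hq : ∀ s, ∃ x, Agree (q x) s) (φ : Formula Atom)
    (s : CanonicalWorld Atom) (x : X) (h : Agree (q x) s) :
    φ ∈ s.1 ↔ Sat (stableSets q) (stableInterp q) x (stableView q s) φ := by
  induction φ generalizing s x with
  | top => exact iff_of_true (top_mem s) trivial
  | bot => exact iff_of_false (bot_notMem s) id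
  | atom a => exact (h _ (.atom a)).symm
  | neg φ ih => rw [neg_mem, ih s x h]; rfl
  | and φ ψ ih ih' => rw [and_mem, ih s x h, ih' s x h]; rfl
  | box φ ih =>
    constructor
    · rintro hs V ⟨κ, hκ, rfl⟩ hVs hxV
      -- Since the closed set lies inside the view of `s`, the successor `t` has exactly that set as
      -- its view.
      obtain ⟨t, hst, -, ht⟩ := exists_R₁_stableView_eq q hκ
        fun ψ hψ => (h _ (hκ ψ hψ).inner).1 (hxV ψ hψ)
      rw [Set.inter_eq_right.2 hVs] at ht
      rw [← ht]
      exact (ih t x (h.trans (agree_of_R₁ hst))).1 (hst hs)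
    · intro hs
      refine box_mem.2 fun t hst => ?_
      have hxt := h.trans (agree_of_R₁ hst)
      exact (ih t x hxt).2 (hs _ (stableView_mem_stableSets q t)
        (stableView_subset_of_R₁ q hst) (mem_stableView_of_agree q hxt))
  | know φ ih =>
    constructor
    · intro hs y hy
      obtain ⟨t, hst, ht⟩ := exists_R₂_agree q hy
      rw [stableView_eq_of_R₂ q hst]
      exact (ih t y ht).1 (hst hs)
    · intro hs
      refine know_mem.2 fun t hst => ?_
      obtain ⟨y, hy⟩ := hq t
      refine (ih t y hy).2 ?_
      rw [← stableView_eq_of_R₂ q hst]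
      refine hs y ?_
      rw [stableView_eq_of_R₂ q hst]
      exact mem_stableView_of_agree q hy

theorem isClosedTopology_stableSets : IsClosedTopology (stableSets q) := by
  refine (isClosedTopology_iff _).2 ⟨fun C hC => ?_, ⟨{bot}, ?_, ?_⟩, ?_⟩
  · choose! κ hκ hCκ using fun c (hc : c ∈ C) => hC hc
    refine ⟨⋃ c ∈ C, κ c, ?_, Set.ext fun x => ?_⟩
    · simp only [Set.mem_iUnion]
      rintro ψ ⟨c, hc, hψ⟩
      exact hκ c hc ψ hψ
    · simp only [Set.mem_sInter, innerSet, Set.mem_iUnion, Set.mem_ofPred_eq]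
      constructor
      · rintro h ψ ⟨c, hc, hψ⟩
        have := h c hc
        rw [hCκ c hc] at this
        exact this ψ hψ
      · intro h c hc
        rw [hCκ c hc]
        exact fun ψ hψ => h ψ ⟨c, hc, hψ⟩
  · rintro _ rfl
    exact .bot
  · refine (Set.eq_empty_of_forall_notMem fun x hx => ?_).symm
    exact bot_notMem (q x) (Stable.bot.mem_of_inner (hx bot rfl))
  · rintro _ ⟨κ, hκ, rfl⟩ _ ⟨κ', hκ', rfl⟩
    -- A disjunction of two interiors is its own interior, so unions of basic closed sets are again
    -- basic. Distributing over the two families turns the union of two intersections into one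
    -- intersection.
    have hmem : ∀ (ψ ψ' : Formula Atom), Stable ψ → Stable ψ' → ∀ w : CanonicalWorld Atom,
        inner (neg (and (neg (inner ψ)) (neg (inner ψ')))) ∈ w.1 ↔
          inner ψ ∈ w.1 ∨ inner ψ' ∈ w.1 := by
      intro ψ ψ' hψ hψ' w
      constructor
      · intro h
        have := (hψ.inner.neg.and hψ'.inner.neg).neg.mem_of_inner h
        simp only [neg_mem, and_mem] at this; tauto
      · intro h
        have mono : ∀ α β : Formula Atom,
            (∀ t : CanonicalWorld Atom, α ∈ t.1 → β ∈ t.1) → inner α ∈ w.1 → inner β ∈ w.1 := by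
          intro α β hαβ hα
          obtain ⟨t, ht, htα⟩ := inner_mem.1 hα
          exact inner_mem.2 ⟨t, ht, know_mem.2 fun r hr => hαβ r (hr htα)⟩
        rcases h with h | h
        · refine mono _ _ (fun t ht => ?_) (hψ.inner_inner_mem.2 h)
          simp only [neg_mem, and_mem]; tauto
        · refine mono _ _ (fun t ht => ?_) (hψ'.inner_inner_mem.2 h)
          simp only [neg_mem, and_mem]; tauto
    refine ⟨{α | ∃ ψ ∈ κ, ∃ ψ' ∈ κ', α = neg (and (neg (inner ψ)) (neg (inner ψ')))}, ?_,
      Set.ext fun x => ?_⟩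
    · rintro _ ⟨ψ, hψ, ψ', hψ', rfl⟩
      exact ((hκ ψ hψ).inner.neg.and (hκ' ψ' hψ').inner.neg).neg
    · constructor
      · rintro hx _ ⟨ψ, hψ, ψ', hψ', rfl⟩
        exact (hmem ψ ψ' (hκ ψ hψ) (hκ' ψ' hψ') _).2
          (hx.imp (fun h => h ψ hψ) fun h => h ψ' hψ')
      · intro hx
        by_contra hn
        simp only [Set.mem_union, innerSet, Set.mem_ofPred_eq, not_or, not_forall] at hn
        obtain ⟨⟨ψ, hψ, h1⟩, ψ', hψ', h2⟩ := hn
        exact ((hmem ψ ψ' (hκ ψ hψ) (hκ' ψ' hψ') _).1 (hx _ ⟨ψ, hψ, ψ', hψ', rfl⟩)).elim h1 h2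

end Model

/-! ### Soundness -/

section Soundness

variable {X : Type v} {O : Set (Set X)} {i : Atom → Set X} {x : X} {U : Set X}

theorem sat_imp {φ ψ : Formula Atom} :
    Sat O i x U (imp φ ψ) ↔ (Sat O i x U φ → Sat O i x U ψ) := by
  simp only [imp, Sat]; tauto

theorem sat_dia {φ : Formula Atom} :
    Sat O i x U (dia φ) ↔ ∃ V ∈ O, V ⊆ U ∧ x ∈ V ∧ Sat O i x V φ := by
  simp only [dia, Sat]; push Not; rfl

theorem sat_poss {φ : Formula Atom} :
    Sat O i x U (poss φ) ↔ ∃ y ∈ U, Sat O i y U φ := by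
  simp only [poss, Sat]; push Not; rfl

/-- Only two axioms use the closure properties: directedness needs `V ∩ W`, and the union axiom
needs `V ∪ W`. -/
theorem Provable.sat {φ : Formula Atom} (h : Provable φ) (hO : IsClosedTopology O) (hU : U ∈ O)
    (hx : x ∈ U) : Sat O i x U φ := by
  obtain ⟨hinter, -, hunion⟩ := (isClosedTopology_iff O).1 hO
  induction h generalizing x U with
  | taut h => exact h (Sat O i x U) trivial id (fun _ => Iff.rfl) fun _ _ => Iff.rfl
  | atomic h =>
    cases h with
    | top => simp [Sat, sat_imp]
    | bot => simp [Sat, sat_imp]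
    | atom a => exact ⟨sat_imp.2 fun h _ _ _ _ => h, sat_imp.2 fun h _ _ _ _ => h⟩
  | box_normal φ ψ =>
    simp only [sat_imp, Sat]
    exact fun h h' V hV hVU hxV => h V hV hVU hxV (h' V hV hVU hxV)
  | box_refl φ => exact sat_imp.2 fun h => h U hU subset_rfl hx
  | box_trans φ =>
    exact sat_imp.2 fun h V _ hVU _ W hW hWV hxW => h W hW (hWV.trans hVU) hxW
  | know_normal φ ψ =>
    simp only [sat_imp, Sat]
    exact fun h h' y hy => h y hy (h' y hy)
  | know_refl φ => exact sat_imp.2 fun h => h x hx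
  | know_trans φ => exact sat_imp.2 fun h y _ => h
  | know_symm φ => exact sat_imp.2 fun h y _ => sat_poss.2 ⟨x, hx, h⟩
  | know_box φ =>
    exact sat_imp.2 fun h V hV hVU _ y hy => h y (hVU hy) V hV hVU hy
  | directed φ =>
    refine sat_imp.2 fun h W hW hWU hxW => ?_
    obtain ⟨V, hV, hVU, hxV, hφ⟩ := sat_dia.1 h
    have hVW : V ∩ W ∈ O := by
      have := hinter {V, W} (by rintro _ (rfl | rfl) <;> assumption)
      rwa [Set.sInter_pair] at this
    exact sat_dia.2 ⟨V ∩ W, hVW, Set.inter_subset_right, ⟨hxV, hxW⟩,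
      hφ _ hVW Set.inter_subset_left ⟨hxV, hxW⟩⟩
  | union φ ψ χ =>
    refine sat_imp.2 ?_
    rintro ⟨h, h'⟩
    obtain ⟨V, hV, hVU, hxV, hφ, hψ⟩ := sat_dia.1 h
    obtain ⟨y, hy, h'⟩ := sat_poss.1 h'
    obtain ⟨W, hW, hWU, hyW, hφ', hχ⟩ := sat_dia.1 h'
    refine sat_dia.2 ⟨V ∪ W, hunion V hV W hW, Set.union_subset hVU hWU, .inl hxV,
      ⟨fun z hz => ?_, sat_dia.2 ⟨V, hV, Set.subset_union_left, hxV, hψ⟩⟩,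
      sat_poss.2 ⟨y, .inr hyW, sat_dia.2 ⟨W, hW, Set.subset_union_right, hyW, hχ⟩⟩⟩
    rcases hz with hz | hz
    · exact sat_dia.2 ⟨V, hV, Set.subset_union_left, hz, hφ z hz⟩
    · exact sat_dia.2 ⟨W, hW, Set.subset_union_right, hz, hφ' z hz⟩
  | mp _ _ ih ih' => exact sat_imp.1 (ih hU hx) (ih' hU hx)
  | know_nec _ ih => exact fun y hy => ih hU hy
  | box_nec _ ih => exact fun V hV _ hxV => ih hV hxV

theorem Derives.sat {Γ : Set (Formula Atom)} {φ : Formula Atom} (h : Derives Γ φ)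
    (hO : IsClosedTopology O) (hU : U ∈ O) (hx : x ∈ U) (hΓ : ∀ γ ∈ Γ, Sat O i x U γ) :
    Sat O i x U φ := by
  obtain ⟨l, hl, p⟩ := h
  exact sat_imp.1 (p.sat hO hU hx) ((valuation_conj (v := Sat O i x U) trivial
    (fun _ _ => Iff.rfl) l).2 fun ψ hψ => hΓ ψ (hl ψ hψ))

/-- The formulas true at a point of a model over a closed topological frame form a world. -/
theorem maxConsistent_setOf_sat (i : Atom → Set X) (hO : IsClosedTopology O) (hU : U ∈ O)
    (hx : x ∈ U) : MaxConsistent {φ | Sat O i x U φ} := by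
  refine ⟨fun h => h.sat hO hU hx fun _ => id, fun Δ hΔ hsub => ?_⟩
  refine Set.Subset.antisymm (fun φ hφ => ?_) hsub
  by_contra hn
  obtain ⟨w, hw⟩ := exists_maxConsistent hΔ
  have hn : neg φ ∈ {φ | Sat O i x U φ} := hn
  exact (neg_mem w).1 (hw (hsub hn)) (hw hφ)

end Soundness

/-! ### Completeness -/

theorem closedTopSatisfiable_of_consistent {Γ : Set (Formula Atom)} (h : Consistent Γ) :
    ClosedTopSatisfiable.{v} Γ := by
  obtain ⟨w, hw⟩ := exists_maxConsistent h
  -- The lift places the model in the arbitrary universe of the semantic statement.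
  let q : ULift.{v} (CanonicalWorld Atom) → CanonicalWorld Atom := ULift.down
  refine ⟨_, stableSets q, stableInterp q, isClosedTopology_stableSets q, ⟨w⟩, stableView q w,
    stableView_mem_stableSets q w, mem_stableView_of_agree q fun _ _ => Iff.rfl, fun γ hγ => ?_⟩
  exact (mem_iff_sat q (fun s => ⟨⟨s⟩, fun _ _ => Iff.rfl⟩) γ w ⟨w⟩ fun _ _ => Iff.rfl).1 (hw hγ)

theorem consistent_iff_closedTopSatisfiable (Γ : Set (Formula Atom)) :
    Consistent Γ ↔ ClosedTopSatisfiable.{v} Γ := by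
  refine ⟨closedTopSatisfiable_of_consistent, ?_⟩
  rintro ⟨X, O, i, hO, x, U, hU, hx, hΓ⟩ hd
  exact hd.sat hO hU hx hΓ

theorem derives_iff_closedTopConsequence (Γ : Set (Formula Atom)) (φ : Formula Atom) :
    Derives Γ φ ↔ ClosedTopConsequence.{v} Γ φ := by
  refine ⟨fun h X O i hO x U hU hx => h.sat hO hU hx, fun h => ?_⟩
  by_contra hn
  obtain ⟨X, O, i, hO, x, U, hU, hx, hΓ⟩ :=
    closedTopSatisfiable_of_consistent.{v} (consistent_insert_neg hn)
  exact hΓ _ (Set.mem_insert _ _)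
    (h X O i hO x U hU hx fun γ hγ => hΓ γ (Set.mem_insert_of_mem _ hγ))

/-! ### Worlds as pointed views -/

instance : Nonempty (CanonicalWorld Atom) := by
  refine ⟨⟨_, maxConsistent_setOf_sat (X := Unit) (O := Set.univ) (x := ()) (U := Set.univ)
    (fun _ => ∅) ?_ trivial trivial⟩⟩
  exact (isClosedTopology_iff _).2 ⟨fun _ _ => trivial, trivial, fun _ _ _ _ => trivial⟩

section Model

variable {X : Type v} (q : X → CanonicalWorld Atom)

/-- Conversely, if `□φ ∈ s`, the truth lemma makes `φ` true at the common point in the smaller view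
of `t`, and hence puts `φ` in `t`. -/
theorem R₁_iff (hq : ∀ s, ∃ x, Agree (q x) s) {s t : CanonicalWorld Atom} :
    (canonicalFrame Atom).R₁ s t ↔ Agree s t ∧ stableView q t ⊆ stableView q s := by
  refine ⟨fun h => ⟨agree_of_R₁ h, stableView_subset_of_R₁ q h⟩, fun ⟨h, h'⟩ φ hφ => ?_⟩
  obtain ⟨x, hx⟩ := hq s
  have hxt := hx.trans h
  exact (mem_iff_sat q hq φ t x hxt).2 ((mem_iff_sat q hq (box φ) s x hx).1 hφ _
    (stableView_mem_stableSets q t) h' (mem_stableView_of_agree q hxt))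

theorem R₂_iff (hq : ∀ s, ∃ x, Agree (q x) s) {s t : CanonicalWorld Atom} :
    (canonicalFrame Atom).R₂ s t ↔ stableView q s = stableView q t := by
  refine ⟨stableView_eq_of_R₂ q, fun h φ hφ => ?_⟩
  obtain ⟨x, hx⟩ := hq s
  obtain ⟨y, hy⟩ := hq t
  refine (mem_iff_sat q hq φ t y hy).2 ?_
  rw [← h]
  refine (mem_iff_sat q hq (know φ) s x hx).1 hφ y ?_
  rw [h]
  exact mem_stableView_of_agree q hy

theorem eq_of_agree_of_stableView_eq (hq : ∀ s, ∃ x, Agree (q x) s)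
    {s t : CanonicalWorld Atom} (h : Agree s t) (h' : stableView q s = stableView q t) :
    s = t := by
  obtain ⟨x, hx⟩ := hq s
  refine ext_of_subset fun φ hφ => (mem_iff_sat q hq φ t x (hx.trans h)).2 ?_
  rw [← h']
  exact (mem_iff_sat q hq φ s x hx).1 hφ

/-- Some world views all points of the model. -/
theorem exists_stableView_eq_univ (hq : ∀ s, ∃ x, Agree (q x) s) :
    ∃ s, stableView q s = Set.univ := by
  obtain ⟨x, -⟩ := hq (Classical.arbitrary _)
  have huniv : Set.univ ∈ stableSets q :=
    ⟨∅, fun _ h => h.elim, (Set.eq_univ_of_forall fun _ _ h => h.elim).symm⟩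
  -- The world is the theory of a point with the whole space as view. A stable formula it knows is
  -- true at every `y` in the view `Set.univ`; it must be brought down to the view of `q y`, where
  -- the truth lemma applies.
  refine ⟨⟨_, maxConsistent_setOf_sat (stableInterp q) (isClosedTopology_stableSets q) huniv
    (Set.mem_univ x)⟩, Set.eq_univ_of_forall fun y φ hφ hs => ?_⟩
  have hy : Sat (stableSets q) (stableInterp q) y Set.univ φ := hs y trivial
  -- Stability is a statement about all worlds, so it amounts to a theorem `φ → □φ`, valid in this
  -- model by soundness.
  have hbox : Provable (imp φ (box φ)) := provable_iff.2 fun w =>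
    (imp_mem w).2 fun hw => box_mem.2 fun t ht => (hφ w t ht).1 hw
  have := sat_imp.1 (hbox.sat (isClosedTopology_stableSets q) huniv (Set.mem_univ y)) hy
  exact (mem_iff_sat q hq φ (q y) y fun _ _ => Iff.rfl).2 (this _
    (stableView_mem_stableSets q (q y)) (Set.subset_univ _)
    (mem_stableView_of_agree q fun _ _ => Iff.rfl))

end Model

/-! ### Ending points -/

theorem agree_id (s : CanonicalWorld Atom) : ∃ x : CanonicalWorld Atom, Agree (id x) s :=
  ⟨s, fun _ _ => Iff.rfl⟩

/-- Whatever stable formula a successor of `s` knows has its interior in `e`, so `e` knows it too.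
Thus `e` has the smallest view among these worlds. -/
theorem isEndingPoint_of_agree {s e : CanonicalWorld Atom} (h : Agree s e)
    (h' : ∀ ψ, Stable ψ → inner ψ ∈ e.1 → know ψ ∈ e.1) :
    (canonicalFrame Atom).IsEndingPoint s e := by
  intro s' hs'
  have hag : Agree s' e := (agree_of_R₁ hs').symm.trans h
  exact (R₁_iff id agree_id).2 ⟨hag, fun x hx φ hφ hs => hx φ hφ
    (h' φ hφ ((hag _ hφ.inner).1 (inner_mem.2 ⟨s', canonical_refl₁ s', hs⟩)))⟩

/-- Cut the view of `s` by all interiors true in `s` at once, that is, by the smallest closed set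
around its point. -/
theorem exists_agree_know_of_inner (s : CanonicalWorld Atom) :
    ∃ e, (canonicalFrame Atom).R₁ s e ∧ ∀ ψ, Stable ψ → inner ψ ∈ e.1 → know ψ ∈ e.1 := by
  obtain ⟨e, hse, he, -⟩ := exists_R₁_stableView_eq id (s := s)
    (κ := {ψ | Stable ψ ∧ inner ψ ∈ s.1}) (fun _ h => h.1) fun _ h => h.2
  exact ⟨e, hse, fun ψ hψ h => he ψ ⟨hψ, (hψ.inner s e hse).2 h⟩⟩

theorem isEndingPoint_iff {s e : CanonicalWorld Atom} :
    (canonicalFrame Atom).IsEndingPoint s e ↔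
      Agree s e ∧ ∀ ψ, Stable ψ → inner ψ ∈ e.1 → know ψ ∈ e.1 := by
  refine ⟨fun h => ?_, fun h => isEndingPoint_of_agree h.1 h.2⟩
  have hse := agree_of_R₁ (h s (canonical_refl₁ s))
  obtain ⟨t, hst, ht⟩ := exists_agree_know_of_inner s
  have hte := h t hst
  exact ⟨hse, fun ψ hψ h => hψ.know_mem_of_R₁ hte
    (ht ψ hψ ((agree_of_R₁ hte _ hψ.inner).2 h))⟩

theorem exists_isEndingPoint (s : CanonicalWorld Atom) :
    ∃ e, (canonicalFrame Atom).IsEndingPoint s e := by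
  obtain ⟨e, hse, he⟩ := exists_agree_know_of_inner s
  exact ⟨e, isEndingPoint_of_agree (agree_of_R₁ hse) he⟩

theorem CanonicalPoint.know_of_inner (e : CanonicalPoint Atom) {ψ : Formula Atom}
    (hψ : Stable ψ) (h : inner ψ ∈ e.1.1) : know ψ ∈ e.1.1 :=
  have ⟨_, hs⟩ := e.2
  (isEndingPoint_iff.1 hs).2 ψ hψ h

theorem CanonicalPoint.isEndingPoint {e : CanonicalPoint Atom} {s : CanonicalWorld Atom} :
    (canonicalFrame Atom).IsEndingPoint s e.1 ↔ Agree s e.1 :=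
  ⟨fun h => (isEndingPoint_iff.1 h).1,
    fun h => isEndingPoint_of_agree h fun _ hψ => e.know_of_inner hψ⟩

/-- At an ending point, knowing a stable `φ` is equivalent to the stable formula `inner φ`. The
stable formulas therefore determine the view as well, and with it the world. -/
theorem CanonicalPoint.eq_of_agree {e e' : CanonicalPoint Atom} (h : Agree e.1 e'.1) :
    e = e' := by
  refine Subtype.ext (eq_of_agree_of_stableView_eq id agree_id h (Set.ext fun x => ?_))
  have key : ∀ d : CanonicalPoint Atom, ∀ φ, Stable φ → (know φ ∈ d.1.1 ↔ inner φ ∈ d.1.1) :=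
    fun d φ hφ => ⟨fun h => inner_mem.2 ⟨_, canonical_refl₁ _, h⟩, d.know_of_inner hφ⟩
  refine forall_congr' fun φ => forall_congr' fun hφ => imp_congr_left ?_
  rw [key e φ hφ, key e' φ hφ, h _ hφ.inner]

/-- The ending point of a world, as a point of the canonical subset model. -/
noncomputable def endingPoint (s : CanonicalWorld Atom) : CanonicalPoint Atom :=
  ⟨(exists_isEndingPoint s).choose, s, (exists_isEndingPoint s).choose_spec⟩

theorem isEndingPoint_endingPoint (s : CanonicalWorld Atom) :
    (canonicalFrame Atom).IsEndingPoint s (endingPoint s).1 :=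
  (exists_isEndingPoint s).choose_spec

theorem endingPoint_agree (s : CanonicalWorld Atom) : Agree (endingPoint s).1 s :=
  (CanonicalPoint.isEndingPoint.1 (isEndingPoint_endingPoint s)).symm

theorem agree_val (s : CanonicalWorld Atom) : ∃ x : CanonicalPoint Atom, Agree x.1 s :=
  ⟨_, endingPoint_agree s⟩

theorem endingPoint_eq_iff {s t : CanonicalWorld Atom} :
    endingPoint s = endingPoint t ↔ Agree s t := by
  refine ⟨fun h => (endingPoint_agree s).symm.trans (h ▸ endingPoint_agree t), fun h => ?_⟩
  exact CanonicalPoint.eq_of_agree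
    ((endingPoint_agree s).trans (h.trans (endingPoint_agree t).symm))

/-! ### The canonical subset model -/

theorem canonicalView_eq (s : CanonicalWorld Atom) :
    canonicalView s = stableView Subtype.val s := by
  ext e
  constructor
  · rintro ⟨t, hts, ht⟩
    rw [← stableView_eq_of_R₂ _ hts]
    exact mem_stableView_of_agree _ (CanonicalPoint.isEndingPoint.1 ht).symm
  · intro he
    obtain ⟨t, hst, ht⟩ := exists_R₂_agree _ he
    exact ⟨t, canonical_symm₂ hst, CanonicalPoint.isEndingPoint.2 ht.symm⟩

theorem canonicalSets_eq :
    canonicalSets Atom = stableSets (Subtype.val : CanonicalPoint Atom → _) := by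
  ext C
  constructor
  · rintro (rfl | ⟨s, rfl⟩)
    · exact ((isClosedTopology_iff _).1 (isClosedTopology_stableSets _)).2.1
    · rw [canonicalView_eq]
      exact stableView_mem_stableSets _ s
  · rintro ⟨κ, hκ, rfl⟩
    refine (Set.eq_empty_or_nonempty _).imp id ?_
    rintro ⟨e, he⟩
    -- To realize a closed set containing `e` as a view, start from a world viewing everything, move
    -- to its alternative at `e`, and shrink.
    obtain ⟨s, hs⟩ := exists_stableView_eq_univ Subtype.val (agree_val (Atom := Atom))
    obtain ⟨t, hst, ht⟩ := exists_R₂_agree Subtype.val (s := s) (x := e) (hs ▸ Set.mem_univ e)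
    obtain ⟨t', -, -, ht'⟩ := exists_R₁_stableView_eq Subtype.val (s := t) hκ
      fun ψ hψ => (ht _ (hκ ψ hψ).inner).1 (he ψ hψ)
    rw [← stableView_eq_of_R₂ _ hst, hs, Set.univ_inter] at ht'
    exact ⟨t', by rw [canonicalView_eq, ht']⟩

theorem isClosedTopology_canonicalSets : IsClosedTopology (canonicalSets Atom) :=
  canonicalSets_eq ▸ isClosedTopology_stableSets _

theorem endingPoint_mem_canonicalView (s : CanonicalWorld Atom) :
    endingPoint s ∈ canonicalView s :=
  ⟨s, canonical_refl₂ s, isEndingPoint_endingPoint s⟩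

/-- The map `s ↦ (s₀, U_s)`. -/
noncomputable def canonicalPair (s : CanonicalWorld Atom) :
    PointedProduct (canonicalSets Atom) :=
  ⟨(endingPoint s, canonicalView s), .inr ⟨s, rfl⟩, endingPoint_mem_canonicalView s⟩

theorem canonicalPair_bijective : Function.Bijective (canonicalPair (Atom := Atom)) := by
  constructor
  · intro s t h
    have h1 : endingPoint s = endingPoint t := congrArg (fun p => p.1.1) h
    have h2 : canonicalView s = canonicalView t := congrArg (fun p => p.1.2) h
    rw [canonicalView_eq, canonicalView_eq] at h2
    exact eq_of_agree_of_stableView_eq _ agree_val (endingPoint_eq_iff.1 h1) h2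
  · rintro ⟨⟨e, C⟩, hC, he⟩
    change C ∈ canonicalSets Atom at hC
    change e ∈ C at he
    rcases hC with rfl | ⟨s, rfl⟩
    · exact he.elim
    obtain ⟨t, hts, ht⟩ := he
    refine ⟨t, Subtype.ext (Prod.ext ?_ ?_)⟩
    · exact CanonicalPoint.eq_of_agree
        ((endingPoint_agree t).trans (CanonicalPoint.isEndingPoint.1 ht))
    · change canonicalView t = canonicalView s
      rw [canonicalView_eq, canonicalView_eq, stableView_eq_of_R₂ _ hts]

/-- The isomorphism from the canonical frame onto the canonical subset frame. -/
noncomputable def canonicalIso :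
    FrameIso (canonicalFrame Atom) (subsetFrame (canonicalSets Atom)) where
  toEquiv := Equiv.ofBijective canonicalPair canonicalPair_bijective
  map_R₁ s t := by
    change endingPoint s = endingPoint t ∧ canonicalView t ⊆ canonicalView s ↔ _
    rw [endingPoint_eq_iff, R₁_iff Subtype.val agree_val, canonicalView_eq, canonicalView_eq]
  map_R₂ s t := by
    change canonicalView s = canonicalView t ↔ _
    rw [R₂_iff Subtype.val agree_val, canonicalView_eq, canonicalView_eq]

theorem mem_iff_sat_canonical (s : CanonicalWorld Atom) (φ : Formula Atom) :
    φ ∈ s.1 ↔ Sat (canonicalSets Atom) canonicalInterp (endingPoint s) (canonicalView s) φ := by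
  rw [canonicalSets_eq, canonicalView_eq]
  exact mem_iff_sat Subtype.val agree_val φ s _ (endingPoint_agree s)

/-! ### The frame conditions -/

theorem subsetFrame_conditions {X : Type u} [Nonempty X] {O : Set (Set X)}
    (hO : IsClosedTopology O) : (subsetFrame O).Conditions := by
  obtain ⟨hinter, -, hunion⟩ := (isClosedTopology_iff O).1 hO
  have huniv : Set.univ ∈ O := by simpa using hinter ∅ (Set.empty_subset _)
  refine ⟨fun s => ⟨rfl, subset_rfl⟩, fun s t r h h' => ⟨h.1.trans h'.1, h'.2.trans h.2⟩,
    ⟨fun _ => rfl, fun h => h.symm, fun h h' => h.trans h'⟩, ?_, ?_, ?_, ?_, ?_, ?_⟩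
  · rintro ⟨⟨x, U⟩, hU, hx⟩ ⟨⟨y, V⟩, hV, hy⟩ ⟨⟨⟨z, W⟩, hW, hz⟩, ⟨h1, h2⟩, h3⟩
    change W = V at h3
    subst h3
    exact ⟨⟨(y, U), hU, h2 hy⟩, rfl, rfl, h2⟩
  · rintro ⟨⟨x, U⟩, hU, hx⟩
    -- The ending point pairs `x` with the smallest closed set containing it, its closure.
    refine ⟨⟨(x, ⋂₀ {C | C ∈ O ∧ x ∈ C}), hinter _ fun C hC => hC.1, fun C hC => hC.2⟩, ?_⟩
    rintro ⟨⟨y, V⟩, hV, hy⟩ ⟨h1, h2⟩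
    change x = y at h1
    subst h1
    exact ⟨rfl, Set.sInter_subset_of_mem ⟨hV, hy⟩⟩
  · rintro ⟨⟨x, U⟩, hU, hx⟩ ⟨⟨y, V⟩, hV, hy⟩ ⟨r, hr, hr'⟩ h h'
    have hxy : x = y := hr.1.trans hr'.1.symm
    -- A common successor forces equal points, so each half of the back-and-forth hypothesis is an
    -- inclusion of views.
    have key : ∀ {A B : Set X} (hA : A ∈ O) {a b : X} (ha : a ∈ A ) (hB : B ∈ O) (hb : b ∈ B),
        (∀ t, (subsetFrame O).R₂ t ⟨(a, A), hA, ha⟩ → ∃ t' t₀,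
          (subsetFrame O).R₂ t' ⟨(b, B), hB, hb⟩ ∧ (subsetFrame O).R₁ t t₀ ∧
            (subsetFrame O).R₁ t' t₀) → A ⊆ B := by
      intro A B hA a b ha hB hb h z hz
      obtain ⟨t', t₀, h1, h2, h3⟩ := h ⟨(z, A), hA, hz⟩ rfl
      have h4 : t'.1.2 = B := h1
      have h5 : z = t'.1.1 := h2.1.trans h3.1.symm
      rw [h5, ← h4]
      exact t'.2.2
    have hUV : U = V := (key hU hx hV hy h).antisymm (key hV hy hU hx h')
    subst hxy hUV
    rfl
  · rintro ⟨⟨x, U⟩, hU, hx⟩ ⟨⟨y, V⟩, hV, hy⟩ -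
    refine ⟨⟨(x, U ∪ V), hunion U hU V hV, .inl hx⟩,
      ⟨⟨⟨(x, U ∪ V), hunion U hU V hV, .inl hx⟩, rfl, rfl, Set.subset_union_left⟩,
        ⟨⟨(y, U ∪ V), hunion U hU V hV, .inr hy⟩, rfl, rfl, Set.subset_union_right⟩⟩, ?_⟩
    rintro ⟨⟨z, W⟩, hW, hz⟩ h
    change W = U ∪ V at h
    subst h
    rcases hz with hz | hz
    · exact .inl ⟨⟨(z, U), hU, hz⟩, ⟨rfl, Set.subset_union_left⟩, rfl⟩
    · exact .inr ⟨⟨(z, V), hV, hz⟩, ⟨rfl, Set.subset_union_right⟩, rfl⟩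
  · rintro I s ⟨r, hr⟩
    have hmem : ⋂ i, (s i).1.2 ∈ O := hinter _ (by rintro _ ⟨i, rfl⟩; exact (s i).2.1)
    -- The common successor `r` supplies a point of the intersection, including for an empty family,
    -- where the intersection is the whole space.
    refine ⟨⟨(r.1.1, ⋂ i, (s i).1.2), hmem, Set.mem_iInter.2 fun i => (hr i).2 r.2.2⟩, ?_⟩
    rintro t ht ⟨t₀, ht₀⟩ i
    refine ⟨⟨((t i).1.1, ⋂ i, (s i).1.2), hmem, Set.mem_iInter.2 fun j => ?_⟩,
      ⟨rfl, ?_⟩, rfl⟩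
    · have h1 : (t i).1.1 = (t j).1.1 := (ht₀ i).1.trans (ht₀ j).1.symm
      have h2 : (t j).1.2 = (s j).1.2 := ht j
      change (t i).1.1 ∈ (s j).1.2
      rw [h1, ← h2]
      exact (t j).2.2
    · have h2 : (t i).1.2 = (s i).1.2 := ht i
      exact (Set.iInter_subset _ i).trans h2.superset
  · obtain ⟨x⟩ := ‹Nonempty X›
    refine ⟨⟨(x, Set.univ), huniv, Set.mem_univ x⟩, fun s => ?_⟩
    exact ⟨⟨(s.1.1, Set.univ), huniv, Set.mem_univ _⟩, rfl, rfl, Set.subset_univ _⟩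

/-- The conditions are first-order in the two relations apart from the indexed families in `inter`,
which are composed with the bijection. -/
theorem FrameIso.conditions {S T : Type u} {F : Frame S} {G : Frame T} (e : FrameIso F G)
    (h : G.Conditions) : F.Conditions := by
  have h1 : ∀ s t, F.R₁ s t ↔ G.R₁ (e.toEquiv s) (e.toEquiv t) := fun s t => (e.map_R₁ s t).symm
  have h2 : ∀ s t, F.R₂ s t ↔ G.R₂ (e.toEquiv s) (e.toEquiv t) := fun s t => (e.map_R₂ s t).symm
  have c12 : ∀ s t, Relation.Comp F.R₁ F.R₂ s t ↔
      Relation.Comp G.R₁ G.R₂ (e.toEquiv s) (e.toEquiv t) := fun s t => by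
    simp only [Relation.Comp, h1, h2, e.toEquiv.surjective.exists]
  have c21 : ∀ s t, Relation.Comp F.R₂ F.R₁ s t ↔
      Relation.Comp G.R₂ G.R₁ (e.toEquiv s) (e.toEquiv t) := fun s t => by
    simp only [Relation.Comp, h1, h2, e.toEquiv.surjective.exists]
  refine ⟨fun s => (h1 _ _).2 (h.refl₁ _), fun s t r => ?_, ⟨fun s => ?_, fun {s t} => ?_,
    fun {s t r} => ?_⟩, fun s t => ?_, fun s => ?_, fun s s' => ?_, fun s₁ s₂ => ?_,
    fun I s => ?_, ?_⟩
  · simpa only [h1] using h.trans₁ _ _ _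
  · exact (h2 _ _).2 (h.equiv₂.refl _)
  · simpa only [h2] using h.equiv₂.symm
  · simpa only [h2] using h.equiv₂.trans
  · simpa only [c12, c21] using h.comm _ _
  · have := h.ending (e.toEquiv s)
    simpa only [Frame.IsEndingPoint, e.toEquiv.surjective.exists, e.toEquiv.surjective.forall,
      ← h1] using this
  · have := h.extensionality (e.toEquiv s) (e.toEquiv s')
    simpa only [e.toEquiv.surjective.exists, e.toEquiv.surjective.forall, ← h1, ← h2,
      e.toEquiv.injective.eq_iff] using this
  · have := h.union (e.toEquiv s₁) (e.toEquiv s₂)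
    simpa only [e.toEquiv.surjective.exists, e.toEquiv.surjective.forall, ← c12, ← c21, ← h2]
      using this
  · rintro ⟨r, hr⟩
    obtain ⟨s', hs'⟩ := h.inter I (fun i => e.toEquiv (s i))
      ⟨e.toEquiv r, fun i => (h1 _ _).1 (hr i)⟩
    obtain ⟨s', rfl⟩ := e.toEquiv.surjective s'
    refine ⟨s', fun t ht ⟨t₀, ht₀⟩ i => (c12 _ _).2 ?_⟩
    exact hs' (fun i => e.toEquiv (t i)) (fun i => (h2 _ _).1 (ht i))
      ⟨e.toEquiv t₀, fun i => (h1 _ _).1 (ht₀ i)⟩ i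
  · obtain ⟨s, hs⟩ := h.strongly_generated
    obtain ⟨s, rfl⟩ := e.toEquiv.surjective s
    exact ⟨s, fun s' => (c21 _ _).2 (hs _)⟩

/-! ### Generated subframes -/

theorem isClosedTopology_subtype {X : Type u} {O : Set (Set X)} (hO : IsClosedTopology O)
    {U : Set X} (hU : U ∈ O) : IsClosedTopology {C : Set U | Subtype.val '' C ∈ O} := by
  obtain ⟨T, rfl⟩ := hO
  exact ⟨inferInstance, Set.ext fun C =>
    (Topology.IsClosedEmbedding.isClosed_iff_image_isClosed
      (IsClosed.isClosedEmbedding_subtypeVal hU)).symm⟩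

section Generated

variable {S X : Type u} {F : Frame S} {O : Set (Set X)} (e : FrameIso F (subsetFrame O))

/-- Neither kind of step enlarges the view. Conversely, two steps suffice: change the point inside
the view of `t`, then shrink the view. -/
theorem FrameIso.reflTransGen_iff (t s : S) :
    Relation.ReflTransGen (fun a b => F.R₁ a b ∨ F.R₂ a b) t s ↔
      (e.toEquiv s).1.2 ⊆ (e.toEquiv t).1.2 := by
  constructor
  · intro h
    induction h with
    | refl => exact subset_rfl
    | tail _ hbc ih =>
      rcases hbc with h | h
      · exact ((e.map_R₁ _ _).2 h).2.trans ih
      · exact ((e.map_R₂ _ _).2 h : (_ : Set X) = _).symm.subset.trans ih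
  · intro h
    obtain ⟨r, hr⟩ := e.toEquiv.surjective
      ⟨((e.toEquiv s).1.1, (e.toEquiv t).1.2), (e.toEquiv t).2.1, h (e.toEquiv s).2.2⟩
    refine .head (b := r) (.inr ((e.map_R₂ _ _).1 ?_)) (.single (.inl ((e.map_R₁ _ _).1 ?_)))
    · change (subsetFrame O).R₂ (e.toEquiv t) (e.toEquiv r)
      rw [hr]
      rfl
    · change (subsetFrame O).R₁ (e.toEquiv r) (e.toEquiv s)
      rw [hr]
      exact ⟨rfl, h⟩

/-- A world of the subframe generated by `t`, as a point with a view in the subspace given by the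
view of `t`. -/
def FrameIso.generatedPair (t : S) (s : F.GeneratedSet t) :
    PointedProduct {C : Set (e.toEquiv t).1.2 | Subtype.val '' C ∈ O} :=
  have h := (e.reflTransGen_iff t s.1).1 s.2
  ⟨(⟨(e.toEquiv s.1).1.1, h (e.toEquiv s.1).2.2⟩, Subtype.val ⁻¹' (e.toEquiv s.1).1.2),
    by
      change Subtype.val '' (Subtype.val ⁻¹' (e.toEquiv s.1).1.2) ∈ O
      rw [Subtype.image_preimage_coe, Set.inter_eq_right.2 h]
      exact (e.toEquiv s.1).2.1,
    (e.toEquiv s.1).2.2⟩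

theorem FrameIso.image_generatedPair (t : S) (s : F.GeneratedSet t) :
    Subtype.val '' (e.generatedPair t s).1.2 = (e.toEquiv s.1).1.2 := by
  change Subtype.val '' (Subtype.val ⁻¹' (e.toEquiv s.1).1.2) = _
  rw [Subtype.image_preimage_coe, Set.inter_eq_right.2 ((e.reflTransGen_iff t s.1).1 s.2)]

theorem FrameIso.generatedPair_bijective (t : S) : Function.Bijective (e.generatedPair t) := by
  constructor
  · intro s s' h
    refine Subtype.ext (e.toEquiv.injective (Subtype.ext (Prod.ext ?_ ?_)))
    · exact congrArg (fun p => p.1.1.1) h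
    · rw [← e.image_generatedPair t s, ← e.image_generatedPair t s', h]
  · rintro ⟨⟨x, C⟩, hC, hx⟩
    -- A closed set of the subspace is pushed forward to the whole space, where it is the view of
    -- some world; its inclusion in the view of `t` makes that world reachable.
    obtain ⟨s, hs⟩ := e.toEquiv.surjective ⟨(x.1, Subtype.val '' C), hC, x, hx, rfl⟩
    refine ⟨⟨s, (e.reflTransGen_iff t s).2 ?_⟩, Subtype.ext (Prod.ext (Subtype.ext ?_) ?_)⟩
    · rw [hs]
      exact Subtype.coe_image_subset _ _
    · change (e.toEquiv s).1.1 = x.1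
      rw [hs]
    · change Subtype.val ⁻¹' (e.toEquiv s).1.2 = C
      rw [hs]
      exact Set.preimage_image_eq _ Subtype.val_injective

/-- A generated subframe of a closed topological frame is the frame of a closed subspace. -/
noncomputable def FrameIso.generated (t : S) : FrameIso (F.generated t)
    (subsetFrame {C : Set (e.toEquiv t).1.2 | Subtype.val '' C ∈ O}) where
  toEquiv := Equiv.ofBijective _ (e.generatedPair_bijective t)
  map_R₁ a b := by
    refine Iff.trans ?_ (e.map_R₁ a.1 b.1)
    refine and_congr Subtype.ext_iff ?_
    change (e.generatedPair t b).1.2 ⊆ (e.generatedPair t a).1.2 ↔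
      (e.toEquiv b.1).1.2 ⊆ (e.toEquiv a.1).1.2
    rw [← e.image_generatedPair t a, ← e.image_generatedPair t b,
      Set.image_subset_image_iff Subtype.val_injective]
  map_R₂ a b := by
    refine Iff.trans ?_ (e.map_R₂ a.1 b.1)
    change (e.generatedPair t a).1.2 = (e.generatedPair t b).1.2 ↔
      (e.toEquiv a.1).1.2 = (e.toEquiv b.1).1.2
    rw [← e.image_generatedPair t a, ← e.image_generatedPair t b,
      Subtype.val_injective.image_injective.eq_iff]

end Generated

instance : Nonempty (CanonicalPoint Atom) := ⟨endingPoint (Classical.arbitrary _)⟩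

end MPStar

theorem mainTheorem2 (Atom : Type) :
    -- strong characterization by closed topological frames, in both usual forms
    ((∀ (Γ : Set (MPStar.Formula Atom)) (φ : MPStar.Formula Atom),
        MPStar.Derives Γ φ ↔ MPStar.ClosedTopConsequence.{v} Γ φ) ∧
      (∀ Γ : Set (MPStar.Formula Atom),
        MPStar.Consistent Γ ↔ MPStar.ClosedTopSatisfiable.{v} Γ)) ∧
    -- the canonical frame satisfies the eight conditions
    (MPStar.canonicalFrame Atom).Conditions ∧
    -- and so does each of its generated subframes, which is a closed topological frame
    (∀ t : MPStar.CanonicalWorld Atom,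
      ((MPStar.canonicalFrame Atom).generated t).Conditions ∧
      MPStar.IsoToClosedTopologicalFrame ((MPStar.canonicalFrame Atom).generated t)) ∧
    -- the canonical frame is isomorphic to a closed topological frame
    MPStar.IsoToClosedTopologicalFrame (MPStar.canonicalFrame Atom) ∧
    -- more precisely, the canonical subset model is a topological space given by its closed sets,
    -- and `s ↦ (s₀, U_s)` identifies the canonical frame, with its truth relation, with it
    MPStar.IsClosedTopology (MPStar.canonicalSets Atom) ∧
    ∃ e : MPStar.FrameIso (MPStar.canonicalFrame Atom)
        (MPStar.subsetFrame (MPStar.canonicalSets Atom)),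
      ∀ s : MPStar.CanonicalWorld Atom,
        (MPStar.canonicalFrame Atom).IsEndingPoint s (e.toEquiv s).1.1.1 ∧
        (e.toEquiv s).1.2 = MPStar.canonicalView s ∧
        ∀ φ : MPStar.Formula Atom, φ ∈ s.1 ↔
          MPStar.Sat (MPStar.canonicalSets Atom) MPStar.canonicalInterp
            (e.toEquiv s).1.1 (e.toEquiv s).1.2 φ := by
  refine ⟨⟨MPStar.derives_iff_closedTopConsequence, MPStar.consistent_iff_closedTopSatisfiable⟩,
    MPStar.canonicalIso.conditions
      (MPStar.subsetFrame_conditions MPStar.isClosedTopology_canonicalSets), fun t => ?_,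
    ⟨_, _, MPStar.isClosedTopology_canonicalSets, ⟨MPStar.canonicalIso⟩⟩,
    MPStar.isClosedTopology_canonicalSets, MPStar.canonicalIso, fun s =>
      ⟨MPStar.isEndingPoint_endingPoint s, rfl, MPStar.mem_iff_sat_canonical s⟩⟩
  have hcl := MPStar.isClosedTopology_subtype MPStar.isClosedTopology_canonicalSets
    (MPStar.canonicalIso.toEquiv t).2.1
  have : Nonempty (MPStar.canonicalIso.toEquiv t).1.2 := ⟨_, (MPStar.canonicalIso.toEquiv t).2.2⟩
  exact ⟨(MPStar.canonicalIso.generated t).conditions (MPStar.subsetFrame_conditions hcl),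
    ⟨_, _, hcl, ⟨MPStar.canonicalIso.generated t⟩⟩⟩
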